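/- **Setting.** Let $G$ be a connected Lie group with Lie algebra $\mathfrak g$, acting smoothly on a smooth manifold $M$, with infinitesimal action $\psi:\mathfrak g\to\Gamma(TM)$ (a Lie algebra homomorphism, $\psi(a)_x=\frac{d}{dt}\big|_{0}\exp(-ta)\cdot x$). Let $E\to M$ be an exact Courant algebroid with pairing $\langle\cdot,\cdot\rangle$, bracket $[\cdot,\cdot]$ and anchor $\pi$, normalised so that $[e,e]=\mathcal D\langle e,e\rangle$, where $\mathcal D=\tfrac12\pi^*\circ d:C^\infty(M)\to\Gamma(E)$ (using $E\cong E^*$). One-forms $\xi$ are regarded as sections of $E$ via $\tfrac12\pi^*\xi$, so that $du$ stands for $\mathcal D u$. Let $\mathcal J$ be a generalized complex structure on $E$, i.e. an orthogonal complex structure on the vector bundle $E$ whose $+i$-eigenbundle is closed under the bracket. For $u\in C^\infty(M,\mathbb C)$ put $D(u)=d(\mathrm{Re}\,u)-\mathcal J\,d(\mathrm{Im}\,u)$. A *Courant algebra* over $\mathfrak g$ is a vector space $\mathfrak a$ with a bilinear bracket and a linear map $\pi:\mathfrak a\to\mathfrak g$ such that $[a_1,[a_2,a_3]]=[[a_1,a_2],a_3]+[a_2,[a_1,a_3]]$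 and $\pi[a_1,a_2]=[\pi a_1,\pi a_2]$; it is *exact* if $\pi$ is onto and the bracket vanishes on $\mathfrak h=\ker\pi$. An *extended action* by an exact $\mathfrak a$ is a bracket-preserving linear map $\rho:\mathfrak a\to\Gamma(E)$ with $\pi(\rho(a))=\psi(\pi(a))$ such that $[\rho(h),\cdot]=0$ for $h\in\mathfrak h$ and the induced action $a\mapsto[\rho(a),\cdot]$ of $\mathfrak g=\mathfrak a/\mathfrak h$ on $\Gamma(E)$ integrates to an action of $G$ on the total space of $E$ (by fibrewise linear maps covering the action on $M$). It is *trivially extended* if $\mathfrak a=\mathfrak g$, $\pi=\mathrm{id}$, and *isotropic* if $\langle\rho(a),\rho(b)\rangle=0$ for all $a,b$. Two extended actions $\rho,\rho'$ by the same $\mathfrak a$ are *equivalent* if they agree on $\mathfrak h$ and $\rho'(a)-\rho(a)=\mathcal D\langle F,\pi(a)\rangle$ for some smooth $G$-equivariant $F:M\to\mathfrak g^*$. A *moment map* for $\rho$ is a linear map $\mu:\mathfrak h\to C^\infty(M)$ with $d\mu_h=\rho(h)$ and $\mathcal L_{\psi(\pi(a))}\mu_h=\mu_{[a,h]}$ for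 all $a\in\mathfrak a$, $h\in\mathfrak h$. The *hemisemidirect product* $\mathfrak g\oplus\mathfrak g$ is the exact Courant algebra with bracket $[(g_1,h_1),(g_2,h_2)]=([g_1,g_2],[g_1,h_2])$ and $\pi(g,h)=g$. **Theorem.** Let $\rho:\mathfrak g\to\Gamma(E)$ be a trivially extended, isotropic action which is Hamiltonian, i.e. $\rho(a)=D(f_a)$ for all $a\in\mathfrak g$, where $f:M\to\mathfrak g_{\mathbb C}^*$ is a smooth function with components $f_a$ which is $\mathfrak g$-equivariant: $\mathcal L_{\psi(a)}f_b=f_{[a,b]}$ for $a,b\in\mathfrak g$. Then 1. $\tilde\rho(a)=\rho(a)-d(\mathrm{Re}\,f_a)$ is a trivially extended action equivalent to $\rho$; 2. there is an extended action $\rho':\mathfrak g\oplus\mathfrak g\to\Gamma(E)$ of the hemisemidirect product Courant algebra which extends $\tilde\rho$, i.e. $\rho'(g,0)=\tilde\rho(g)$, which has moment map $\mathrm{Im}\,f$, i.e. $(0,h)\mapsto\mathrm{Im}\,f_h$, and whose image distribution $K=\rho'(\mathfrak g\oplus\mathfrak g)\subset E$ satisfies $\mathcal JK=K$ at every point of $M$.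 -/

import Mathlib

open Bundle Filter Topology Set
open scoped Manifold ContDiff TensorProduct Bundle

noncomputable section

set_option linter.unusedSectionVars false

/-! ## Smooth functions and smooth sections -/

section Sections

variable (E : Type*) [NormedAddCommGroup E] [NormedSpace ℝ E]
  {M : Type*} [TopologicalSpace M] [ChartedSpace E M]
  (FV : Type*) [NormedAddCommGroup FV] [NormedSpace ℝ FV]
  (V : M → Type*) [TopologicalSpace (TotalSpace FV V)]
  [∀ x, TopologicalSpace (V x)] [FiberBundle FV V]

/-- The space `C^∞(M, ℝ)` of smooth real functions on the manifold `M` modelled on `E`. -/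
abbrev SmoothFun (M : Type*) [TopologicalSpace M] [ChartedSpace E M] : Type _ :=
  C^∞⟮𝓘(ℝ, E), M; ℝ⟯

/-- The space `C^∞(M, ℂ)` of smooth complex functions on the real manifold `M`. -/
abbrev SmoothFunC (M : Type*) [TopologicalSpace M] [ChartedSpace E M] : Type _ :=
  C^∞⟮𝓘(ℝ, E), M; 𝓘(ℝ, ℂ), ℂ⟯

/-- The space `Γ(V)` of smooth sections of the vector bundle `V → M` with model fibre `FV`. -/
abbrev SmoothSec : Type _ := Cₛ^∞⟮𝓘(ℝ, E); FV, V⟯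

variable {E FV V}

/-- The real part of a smooth complex function. -/
def SmoothFunC.re (u : SmoothFunC E M) : SmoothFun E M :=
  ⟨fun x => (u x).re, (Complex.reCLM.contDiff.contMDiff).comp u.contMDiff⟩

/-- The imaginary part of a smooth complex function. -/
def SmoothFunC.im (u : SmoothFunC E M) : SmoothFun E M :=
  ⟨fun x => (u x).im, (Complex.imCLM.contDiff.contMDiff).comp u.contMDiff⟩

variable [∀ x, AddCommGroup (V x)] [∀ x, Module ℝ (V x)] [VectorBundle ℝ FV V]

/-- The product `f • e` of a smooth function and a smooth section. -/
def funSmul (f : SmoothFun E M) (e : SmoothSec E FV V) : SmoothSec E FV V :=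
  ⟨fun x => f x • e x, f.contMDiff.smul_section e.contMDiff⟩

end Sections

/-! ## Courant algebroids -/

/-- A vector bundle `V → M` with a fibrewise nondegenerate symmetric bilinear form, smooth in the
sense that the pairing of two smooth sections is a smooth function, and a smooth bundle map
`anchor : V → TM` covering the identity. -/
structure AnchoredMetricBundle (E : Type*) [NormedAddCommGroup E] [NormedSpace ℝ E]
    {M : Type*} [TopologicalSpace M] [ChartedSpace E M] [IsManifold 𝓘(ℝ, E) ∞ M]
    (FV : Type*) [NormedAddCommGroup FV] [NormedSpace ℝ FV]
    (V : M → Type*) [TopologicalSpace (TotalSpace FV V)]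
    [∀ x, AddCommGroup (V x)] [∀ x, Module ℝ (V x)] [∀ x, TopologicalSpace (V x)]
    [FiberBundle FV V] [VectorBundle ℝ FV V] [ContMDiffVectorBundle ∞ FV V 𝓘(ℝ, E)] where
  pairing : ∀ x, LinearMap.BilinForm ℝ (V x)
  pairing_symm : ∀ x v w, pairing x v w = pairing x w v
  pairing_nondegenerate : ∀ x, (pairing x).Nondegenerate
  contMDiff_pairing : ∀ s t : SmoothSec E FV V,
    ContMDiff 𝓘(ℝ, E) 𝓘(ℝ, ℝ) ∞ (fun x => pairing x (s x) (t x))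
  anchor : ∀ x, V x →ₗ[ℝ] TangentSpace 𝓘(ℝ, E) x
  contMDiff_anchor : ContMDiff (𝓘(ℝ, E).prod 𝓘(ℝ, FV)) 𝓘(ℝ, E).tangent ∞
    (fun p : TotalSpace FV V => (⟨p.1, anchor p.1 p.2⟩ : TangentBundle 𝓘(ℝ, E) M))

section Anchored

variable {E : Type*} [NormedAddCommGroup E] [NormedSpace ℝ E]
  {M : Type*} [TopologicalSpace M] [ChartedSpace E M] [IsManifold 𝓘(ℝ, E) ∞ M]
  {FV : Type*} [NormedAddCommGroup FV] [NormedSpace ℝ FV] [FiniteDimensional ℝ FV]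
  {V : M → Type*} [TopologicalSpace (TotalSpace FV V)]
  [∀ x, AddCommGroup (V x)] [∀ x, Module ℝ (V x)] [∀ x, TopologicalSpace (V x)]
  [FiberBundle FV V] [VectorBundle ℝ FV V] [ContMDiffVectorBundle ∞ FV V 𝓘(ℝ, E)]

namespace AnchoredMetricBundle

variable (B : AnchoredMetricBundle E FV V)

/-- The smooth function `⟨s, t⟩`. -/
def pair (s t : SmoothSec E FV V) : SmoothFun E M :=
  ⟨fun x => B.pairing x (s x) (t x), B.contMDiff_pairing s t⟩

/-- The vector field `π(e)`. -/
def anchorField (e : SmoothSec E FV V) (x : M) : TangentSpace 𝓘(ℝ, E) x := B.anchor x (e x)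

/-- The identification `V_x^* ≅ V_x` given by the pairing: `⟨sharp x φ, v⟩ = φ v`. -/
def sharp (x : M) : Module.Dual ℝ (V x) ≃ₗ[ℝ] V x :=
  haveI : FiniteDimensional ℝ (V x) := VectorBundle.finiteDimensional ℝ FV V x
  ((B.pairing x).toDual (B.pairing_nondegenerate x)).symm

/-- The map `π^* : T^*M → V^* ≅ V`. -/
def coanchor (x : M) : Module.Dual ℝ (TangentSpace 𝓘(ℝ, E) x) →ₗ[ℝ] V x :=
  (B.sharp x).toLinearMap ∘ₗ Module.Dual.transpose (B.anchor x)

/-- The value at `x` of `𝒟 f = ½ π^* (df)`. -/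
def coDiff (f : M → ℝ) (x : M) : V x :=
  (1 / 2 : ℝ) • B.coanchor x (mvfderiv 𝓘(ℝ, E) f x).toLinearMap

lemma pairing_sharp (x : M) (φ : Module.Dual ℝ (V x)) (v : V x) :
    B.pairing x (B.sharp x φ) v = φ v := by
  have : FiniteDimensional ℝ (V x) := VectorBundle.finiteDimensional ℝ FV V x
  exact LinearMap.BilinForm.apply_toDual_symm_apply (hB := B.pairing_nondegenerate x) φ v

lemma coDiff_add {f g : M → ℝ} {x : M} (hf : MDifferentiableAt 𝓘(ℝ, E) 𝓘(ℝ, ℝ) f x)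
    (hg : MDifferentiableAt 𝓘(ℝ, E) 𝓘(ℝ, ℝ) g x) :
    B.coDiff (f + g) x = B.coDiff f x + B.coDiff g x := by
  simp only [coDiff, mvfderiv_add hf hg, ContinuousLinearMap.toLinearMap_add, map_add, smul_add]

lemma coDiff_mul {f g : M → ℝ} {x : M} (hf : MDifferentiableAt 𝓘(ℝ, E) 𝓘(ℝ, ℝ) f x)
    (hg : MDifferentiableAt 𝓘(ℝ, E) 𝓘(ℝ, ℝ) g x) :
    B.coDiff (f * g) x = f x • B.coDiff g x + g x • B.coDiff f x := by
  simp only [coDiff, mvfderiv_mul hf hg, ContinuousLinearMap.toLinearMap_add,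
    ContinuousLinearMap.toLinearMap_smul, map_add, map_smul, smul_add,
    smul_comm (1 / 2 : ℝ)]

lemma coDiff_const_mul (c : ℝ) {f : M → ℝ} {x : M}
    (hf : MDifferentiableAt 𝓘(ℝ, E) 𝓘(ℝ, ℝ) f x) :
    B.coDiff (fun y => c * f y) x = c • B.coDiff f x := by
  have h := B.coDiff_mul (f := fun _ => c) (g := f) mdifferentiableAt_const hf
  have h0 : B.coDiff (fun _ : M => c) x = 0 := by simp [coDiff, mvfderiv_const]
  rw [h0, smul_zero, add_zero] at h
  exact h

end AnchoredMetricBundle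

end Anchored

/-- A Courant algebroid over `M`. -/
structure CourantAlgebroid (E : Type*) [NormedAddCommGroup E] [NormedSpace ℝ E]
    {M : Type*} [TopologicalSpace M] [ChartedSpace E M] [IsManifold 𝓘(ℝ, E) ∞ M]
    (FV : Type*) [NormedAddCommGroup FV] [NormedSpace ℝ FV] [FiniteDimensional ℝ FV]
    (V : M → Type*) [TopologicalSpace (TotalSpace FV V)]
    [∀ x, AddCommGroup (V x)] [∀ x, Module ℝ (V x)] [∀ x, TopologicalSpace (V x)]
    [FiberBundle FV V] [VectorBundle ℝ FV V] [ContMDiffVectorBundle ∞ FV V 𝓘(ℝ, E)]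
    extends AnchoredMetricBundle E FV V where
  bracket : SmoothSec E FV V →ₗ[ℝ] SmoothSec E FV V →ₗ[ℝ] SmoothSec E FV V
  bracket_bracket : ∀ e₁ e₂ e₃,
    bracket e₁ (bracket e₂ e₃) = bracket (bracket e₁ e₂) e₃ + bracket e₂ (bracket e₁ e₃)
  anchor_bracket : ∀ e₁ e₂ x,
    toAnchoredMetricBundle.anchorField (bracket e₁ e₂) x =
      VectorField.mlieBracket 𝓘(ℝ, E) (toAnchoredMetricBundle.anchorField e₁)
        (toAnchoredMetricBundle.anchorField e₂) x
  bracket_funSmul : ∀ e₁ (f : SmoothFun E M) e₂ x,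
    bracket e₁ (funSmul f e₂) x =
      f x • bracket e₁ e₂ x +
        (mvfderiv 𝓘(ℝ, E) f x (toAnchoredMetricBundle.anchorField e₁ x)) • e₂ x
  anchor_pairing : ∀ e₁ e₂ e₃ x,
    mvfderiv 𝓘(ℝ, E) (toAnchoredMetricBundle.pair e₂ e₃) x
        (toAnchoredMetricBundle.anchorField e₁ x) =
      pairing x (bracket e₁ e₂ x) (e₃ x) + pairing x (e₂ x) (bracket e₁ e₃ x)
  bracket_self : ∀ e x,
    bracket e e x = toAnchoredMetricBundle.coDiff (toAnchoredMetricBundle.pair e e) x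

namespace CourantAlgebroid

variable {E : Type*} [NormedAddCommGroup E] [NormedSpace ℝ E]
  {M : Type*} [TopologicalSpace M] [ChartedSpace E M] [IsManifold 𝓘(ℝ, E) ∞ M]
  {FV : Type*} [NormedAddCommGroup FV] [NormedSpace ℝ FV] [FiniteDimensional ℝ FV]
  {V : M → Type*} [TopologicalSpace (TotalSpace FV V)]
  [∀ x, AddCommGroup (V x)] [∀ x, Module ℝ (V x)] [∀ x, TopologicalSpace (V x)]
  [FiberBundle FV V] [VectorBundle ℝ FV V] [ContMDiffVectorBundle ∞ FV V 𝓘(ℝ, E)]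
  (C : CourantAlgebroid E FV V)

/-- The Courant algebroid is exact: `0 → T^*M → V → TM → 0` (with maps `π^*` and `π`) is an exact
sequence of vector bundles. -/
def IsExact : Prop :=
  ∀ x, Function.Injective (C.coanchor x) ∧ Function.Exact (C.coanchor x) (C.anchor x) ∧
    Function.Surjective (C.anchor x)

lemma coDiff_pair (s t : SmoothSec E FV V) (x : M) :
    C.coDiff (C.pair s t) x = (1 / 2 : ℝ) • (C.bracket s t x + C.bracket t s x) := by
  have md : ∀ f : SmoothFun E M, MDifferentiableAt 𝓘(ℝ, E) 𝓘(ℝ, ℝ) f x := fun f =>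
    f.contMDiff.mdifferentiable (by simp) x
  have h := C.bracket_self (s + t) x
  have hp : (C.pair (s + t) (s + t) : M → ℝ) =
      ((C.pair s s : M → ℝ) + fun y => 2 * C.pair s t y) + (C.pair t t : M → ℝ) := by
    funext y
    change C.pairing y (s y + t y) (s y + t y) =
      C.pairing y (s y) (s y) + 2 * C.pairing y (s y) (t y) + C.pairing y (t y) (t y)
    simp only [map_add, LinearMap.add_apply, C.pairing_symm y (t y) (s y)]
    ring
  have m2 : MDifferentiableAt 𝓘(ℝ, E) 𝓘(ℝ, ℝ) (fun y => 2 * C.pair s t y) x :=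
    mdifferentiableAt_const.mul (md _)
  rw [hp, C.coDiff_add ((md _).add m2) (md _), C.coDiff_add (md _) m2,
    C.coDiff_const_mul 2 (md _), ← C.bracket_self, ← C.bracket_self] at h
  simp only [map_add, LinearMap.add_apply, ContMDiffSection.coe_add, Pi.add_apply] at h
  have h2 : (2 : ℝ) • C.coDiff (C.pair s t) x = C.bracket s t x + C.bracket t s x := by
    have := sub_eq_zero.mpr h
    rw [← sub_eq_zero]
    rw [← neg_eq_zero, ← this]
    abel
  rw [← h2, smul_smul]
  norm_num

variable [FiniteDimensional ℝ E] [T2Space M]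

lemma exists_section_eq (x : M) (v : V x) : ∃ s : SmoothSec E FV V, s x = v := by
  obtain ⟨u, hu, hs⟩ := FiberBundle.exists_contMDiffOn_extend (k := ∞) 𝓘(ℝ, E) FV v
  obtain ⟨w, hwu, hwo, hxw⟩ := mem_nhds_iff.mp hu
  obtain ⟨ψ, -, hψ⟩ := ((SmoothBumpFunction.nhds_basis_tsupport (I := 𝓘(ℝ, E)) x).mem_iff).mp
    (hwo.mem_nhds hxw)
  exact ⟨⟨_, (ψ.contMDiff.contMDiffOn (s := w)).smul_section_of_tsupport hwo hψ (hs.mono hwu)⟩,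
    by simp⟩

/-- `𝒟 f` is a smooth section. -/
lemma contMDiff_coDiff (f : SmoothFun E M) :
    ContMDiff 𝓘(ℝ, E) (𝓘(ℝ, E).prod 𝓘(ℝ, FV)) ∞
      (fun x => TotalSpace.mk' FV x (C.coDiff f x)) := by
  intro x₀
  have md : ∀ (f : SmoothFun E M) (x : M), MDifferentiableAt 𝓘(ℝ, E) 𝓘(ℝ, ℝ) f x := fun f x =>
    f.contMDiff.mdifferentiable (by simp) x
  by_cases hv : ∀ v w : V x₀, C.pairing x₀ v w = 0
  · have hz : ∀ v : V x₀, v = 0 := fun v => (C.pairing_nondegenerate x₀).1 v (hv v)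
    have hF : ∀ u : FV, u = 0 := by
      intro u
      exact (map_eq_zero_iff _ (VectorBundle.continuousLinearEquivAt ℝ FV V x₀).symm.injective).mp
        (hz ((VectorBundle.continuousLinearEquivAt ℝ FV V x₀).symm u))
    have hV : ∀ (x : M) (v : V x), v = 0 := by
      intro x v
      exact (map_eq_zero_iff _ (VectorBundle.continuousLinearEquivAt ℝ FV V x).injective).mp
        (hF (VectorBundle.continuousLinearEquivAt ℝ FV V x v))
    have h0 : (fun x => TotalSpace.mk' FV x (C.coDiff f x)) =
        fun x => TotalSpace.mk' FV x ((0 : SmoothSec E FV V) x) := by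
      funext x
      rw [hV x (C.coDiff f x), hV x ((0 : SmoothSec E FV V) x)]
    rw [h0]
    exact (0 : SmoothSec E FV V).contMDiff x₀
  · push Not at hv
    obtain ⟨v, w, hvw⟩ := hv
    obtain ⟨s, hs⟩ := exists_section_eq (E := E) (FV := FV) x₀ v
    obtain ⟨t, ht⟩ := exists_section_eq (E := E) (FV := FV) x₀ w
    set u := C.pair s t with hu
    have hux : u x₀ ≠ 0 := by
      change C.pairing x₀ (s x₀) (t x₀) ≠ 0
      rwa [hs, ht]
    have hfu : (C.pair (funSmul f s) t : M → ℝ) = (f : M → ℝ) * u := by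
      funext y
      change C.pairing y (f y • s y) (t y) = f y * C.pairing y (s y) (t y)
      simp
    let D₁ : SmoothSec E FV V := (1 / 2 : ℝ) • (C.bracket s t + C.bracket t s)
    let D₂ : SmoothSec E FV V :=
      (1 / 2 : ℝ) • (C.bracket (funSmul f s) t + C.bracket t (funSmul f s))
    have key : ∀ x, u x • C.coDiff f x = (D₂ - funSmul f D₁) x := by
      intro x
      have h1 : C.coDiff u x = D₁ x := C.coDiff_pair s t x
      have h2 : C.coDiff ((f : M → ℝ) * u) x = D₂ x := by
        rw [← hfu]
        exact C.coDiff_pair (funSmul f s) t x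
      rw [C.coDiff_mul (md f x) (md u x), h1] at h2
      exact eq_sub_of_add_eq' h2
    have hinv : ContMDiffAt 𝓘(ℝ, E) 𝓘(ℝ, ℝ) ∞ (fun x => (u x)⁻¹) x₀ :=
      (u.contMDiff x₀).inv₀ hux
    have hsm := hinv.smul_section ((D₂ - funSmul f D₁).contMDiff x₀)
    refine hsm.congr_of_eventuallyEq ?_
    filter_upwards [u.contMDiff.continuous.continuousAt.eventually_ne hux] with x hx
    change TotalSpace.mk' FV x (C.coDiff f x) =
      TotalSpace.mk' FV x ((u x)⁻¹ • (D₂ - funSmul f D₁) x)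
    rw [← key x, smul_smul, inv_mul_cancel₀ hx, one_smul]

/-- The operator `𝒟 = ½ π^* ∘ d : C^∞(M) → Γ(V)`. Under the identification of a one-form `ξ` with
the section `½ π^* ξ`, which turns the pairing of a split exact Courant algebroid into
`⟨X + ξ, Y + η⟩ = ½ (η(X) + ξ(Y))`, the section `𝒟 f` is `df`. -/
def D : SmoothFun E M →ₗ[ℝ] SmoothSec E FV V where
  toFun f := ⟨C.coDiff f, C.contMDiff_coDiff f⟩
  map_add' f g := by
    ext x
    exact C.coDiff_add (f.contMDiff.mdifferentiable (by simp) x)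
      (g.contMDiff.mdifferentiable (by simp) x)
  map_smul' c f := by
    ext x
    exact C.coDiff_const_mul c (f.contMDiff.mdifferentiable (by simp) x)

end CourantAlgebroid

/-! ## Generalized complex structures -/

section GeneralizedComplex

variable {E : Type*} [NormedAddCommGroup E] [NormedSpace ℝ E]
  {M : Type*} [TopologicalSpace M] [ChartedSpace E M] [IsManifold 𝓘(ℝ, E) ∞ M]
  {FV : Type*} [NormedAddCommGroup FV] [NormedSpace ℝ FV] [FiniteDimensional ℝ FV]
  {V : M → Type*} [TopologicalSpace (TotalSpace FV V)]
  [∀ x, AddCommGroup (V x)] [∀ x, Module ℝ (V x)] [∀ x, TopologicalSpace (V x)]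
  [FiberBundle FV V] [VectorBundle ℝ FV V] [ContMDiffVectorBundle ∞ FV V 𝓘(ℝ, E)]

/-- The action on smooth sections of a smooth bundle endomorphism covering the identity. -/
def bundleEndSec (J : ∀ x, V x →ₗ[ℝ] V x)
    (hJ : ContMDiff (𝓘(ℝ, E).prod 𝓘(ℝ, FV)) (𝓘(ℝ, E).prod 𝓘(ℝ, FV)) ∞
      (fun p : TotalSpace FV V => TotalSpace.mk' FV p.1 (J p.1 p.2))) :
    SmoothSec E FV V →ₗ[ℝ] SmoothSec E FV V where
  toFun e := ⟨fun x => J x (e x), hJ.comp e.contMDiff⟩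
  map_add' e e' := by
    ext x
    exact map_add (J x) (e x) (e' x)
  map_smul' c e := by
    ext x
    exact map_smul (J x) c (e x)

/-- A generalized complex structure on the Courant algebroid `C`: an orthogonal complex structure
on the vector bundle `V` whose `+i`-eigenbundle `L ⊆ V ⊗ ℂ` is closed under the bracket. Sections
of `V ⊗ ℂ` are the elements of `ℂ ⊗ Γ(V)`, with the complex bilinear extension of the bracket. -/
structure GeneralizedComplexStructure (C : CourantAlgebroid E FV V) where
  J : ∀ x, V x →ₗ[ℝ] V x
  contMDiff_J : ContMDiff (𝓘(ℝ, E).prod 𝓘(ℝ, FV)) (𝓘(ℝ, E).prod 𝓘(ℝ, FV)) ∞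
    (fun p : TotalSpace FV V => TotalSpace.mk' FV p.1 (J p.1 p.2))
  J_J : ∀ x v, J x (J x v) = -v
  orthogonal : ∀ x v w, C.pairing x (J x v) (J x w) = C.pairing x v w
  integrable : ∀ u v : ℂ ⊗[ℝ] SmoothSec E FV V,
    (bundleEndSec J contMDiff_J).baseChange ℂ u = Complex.I • u →
    (bundleEndSec J contMDiff_J).baseChange ℂ v = Complex.I • v →
    (bundleEndSec J contMDiff_J).baseChange ℂ (LinearMap.BilinMap.baseChange ℂ C.bracket u v) =
      Complex.I • LinearMap.BilinMap.baseChange ℂ C.bracket u v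

namespace GeneralizedComplexStructure

variable {C : CourantAlgebroid E FV V} (𝒥 : GeneralizedComplexStructure C)

/-- The map `𝒥 : Γ(V) → Γ(V)`. -/
def onSec : SmoothSec E FV V →ₗ[ℝ] SmoothSec E FV V := bundleEndSec 𝒥.J 𝒥.contMDiff_J

variable [FiniteDimensional ℝ E] [T2Space M]

/-- The Hamiltonian symmetry `D u = d(Re u) - 𝒥 d(Im u)` of a smooth complex function `u`. -/
def hamiltonian (u : SmoothFunC E M) : SmoothSec E FV V := C.D u.re - 𝒥.onSec (C.D u.im)

end GeneralizedComplexStructure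

end GeneralizedComplex

/-! ## Courant algebras -/

/-- A Courant algebra over the Lie algebra `𝔤`. -/
structure CourantAlgebra (𝔤 𝔞 : Type*) [LieRing 𝔤] [LieAlgebra ℝ 𝔤] [AddCommGroup 𝔞]
    [Module ℝ 𝔞] where
  bracket : 𝔞 →ₗ[ℝ] 𝔞 →ₗ[ℝ] 𝔞
  proj : 𝔞 →ₗ[ℝ] 𝔤
  bracket_bracket : ∀ a₁ a₂ a₃,
    bracket a₁ (bracket a₂ a₃) = bracket (bracket a₁ a₂) a₃ + bracket a₂ (bracket a₁ a₃)
  proj_bracket : ∀ a₁ a₂, proj (bracket a₁ a₂) = ⁅proj a₁, proj a₂⁆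

namespace CourantAlgebra

section

variable {𝔤 𝔞 : Type*} [LieRing 𝔤] [LieAlgebra ℝ 𝔤] [AddCommGroup 𝔞] [Module ℝ 𝔞]
  (A : CourantAlgebra 𝔤 𝔞)

/-- The ideal `𝔥 = ker π`. -/
abbrev kernel : Submodule ℝ 𝔞 := LinearMap.ker A.proj

/-- The Courant algebra is exact: `π` is surjective and `𝔥 = ker π` is abelian. -/
def IsExact : Prop :=
  Function.Surjective A.proj ∧ ∀ h₁ ∈ A.kernel, ∀ h₂ ∈ A.kernel, A.bracket h₁ h₂ = 0

/-- The bracket `[a, h] ∈ 𝔥` of `a ∈ 𝔞` and `h ∈ 𝔥`. For an exact Courant algebra this is `g · h`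
with `g = π(a)`. -/
def kernelAct (a : 𝔞) (h : A.kernel) : A.kernel :=
  ⟨A.bracket a h, by
    rw [LinearMap.mem_ker, A.proj_bracket, LinearMap.mem_ker.mp h.2, lie_zero]⟩

end

/-- The Courant algebra `𝔤` over `𝔤`, with `π = id`. -/
def trivial (𝔤 : Type*) [LieRing 𝔤] [LieAlgebra ℝ 𝔤] : CourantAlgebra 𝔤 𝔤 where
  bracket := LinearMap.mk₂ ℝ (fun a b => ⁅a, b⁆) (fun _ _ _ => by simp) (fun _ _ _ => by simp)
    (fun _ _ _ => by simp) (fun _ _ _ => by simp)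
  proj := LinearMap.id
  bracket_bracket a b c := leibniz_lie a b c
  proj_bracket _ _ := rfl

/-- The hemisemidirect product `𝔤 ⊕ 𝔥` of `𝔤` with a `𝔤`-module `𝔥`, with bracket
`[(g₁, h₁), (g₂, h₂)] = ([g₁, g₂], g₁ · h₂)`. -/
def hemisemidirect (𝔤 𝔥 : Type*) [LieRing 𝔤] [LieAlgebra ℝ 𝔤] [AddCommGroup 𝔥] [Module ℝ 𝔥]
    [LieRingModule 𝔤 𝔥] [LieModule ℝ 𝔤 𝔥] : CourantAlgebra 𝔤 (𝔤 × 𝔥) where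
  bracket := LinearMap.mk₂ ℝ (fun a b => (⁅a.1, b.1⁆, ⁅a.1, b.2⁆))
    (fun _ _ _ => by simp) (fun _ _ _ => by simp) (fun _ _ _ => by simp) (fun _ _ _ => by simp)
  proj := LinearMap.fst ℝ 𝔤 𝔥
  bracket_bracket a b c := by
    simp only [LinearMap.mk₂_apply, Prod.mk_add_mk, Prod.mk.injEq]
    exact ⟨leibniz_lie _ _ _, leibniz_lie _ _ _⟩
  proj_bracket _ _ := rfl

end CourantAlgebra

/-! ## Lie groups and extended actions -/

section Group

instance instLEInftyMinSmoothnessThree : ENat.LEInfty (minSmoothness ℝ 3) :=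
  ⟨by
    rw [minSmoothness_of_isRCLikeNormedField]
    exact ENat.LEInfty.out⟩

/-- The Lie algebra `𝔤 = T_1 G` of `G`, with the bracket of left-invariant vector fields. -/
abbrev LieAlg (EG : Type*) [NormedAddCommGroup EG] [NormedSpace ℝ EG]
    (G : Type*) [TopologicalSpace G] [ChartedSpace EG G] [Group G] : Type _ :=
  GroupLieAlgebra 𝓘(ℝ, EG) G

variable {EG : Type*} [NormedAddCommGroup EG] [NormedSpace ℝ EG] [FiniteDimensional ℝ EG]
  {G : Type*} [TopologicalSpace G] [ChartedSpace EG G] [Group G] [LieGroup 𝓘(ℝ, EG) ∞ G]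
  {E : Type*} [NormedAddCommGroup E] [NormedSpace ℝ E]
  {M : Type*} [TopologicalSpace M] [ChartedSpace E M] [IsManifold 𝓘(ℝ, E) ∞ M]
  [MulAction G M]

/-- The adjoint action `Ad g : 𝔤 → 𝔤`, the derivative at `1` of `h ↦ g h g⁻¹`. -/
def Ad (g : G) : LieAlg EG G →ₗ[ℝ] LieAlg EG G :=
  (mfderiv 𝓘(ℝ, EG) 𝓘(ℝ, EG) (fun h : G => g * h * g⁻¹) 1).toLinearMap

/-- The coadjoint action `φ ↦ φ ∘ Ad g⁻¹` of `G` on `𝔤^*`. -/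
def coAd (g : G) (φ : Module.Dual ℝ (LieAlg EG G)) : Module.Dual ℝ (LieAlg EG G) :=
  φ ∘ₗ Ad g⁻¹

variable (E) in
/-- The infinitesimal action `ψ : 𝔤 → Γ(TM)`, `ψ(a)(x) = d/dt exp(-t a) · x` at `t = 0`. The sign
makes it a homomorphism of Lie algebras. -/
def infAction (a : LieAlg EG G) (x : M) : TangentSpace 𝓘(ℝ, E) x :=
  mfderiv 𝓘(ℝ, EG) 𝓘(ℝ, E) (fun g : G => g⁻¹ • x) 1 a

variable {FV : Type*} [NormedAddCommGroup FV] [NormedSpace ℝ FV] [FiniteDimensional ℝ FV]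
  {V : M → Type*} [TopologicalSpace (TotalSpace FV V)]
  [∀ x, AddCommGroup (V x)] [∀ x, Module ℝ (V x)] [∀ x, TopologicalSpace (V x)]
  [FiberBundle FV V] [VectorBundle ℝ FV V] [ContMDiffVectorBundle ∞ FV V 𝓘(ℝ, E)]

/-- A smooth action of `G` on the total space of `V`, linear on the fibres and covering the action
on `M`; it makes `V` a `G`-equivariant vector bundle. -/
structure BundleAction (EG : Type*) [NormedAddCommGroup EG] [NormedSpace ℝ EG]
    (G : Type*) [TopologicalSpace G] [ChartedSpace EG G] [Group G]
    (E : Type*) [NormedAddCommGroup E] [NormedSpace ℝ E]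
    {M : Type*} [TopologicalSpace M] [ChartedSpace E M] [MulAction G M]
    (FV : Type*) [NormedAddCommGroup FV] [NormedSpace ℝ FV]
    (V : M → Type*) [TopologicalSpace (TotalSpace FV V)]
    [∀ x, AddCommGroup (V x)] [∀ x, Module ℝ (V x)] [∀ x, TopologicalSpace (V x)]
    [FiberBundle FV V] where
  act : ∀ (g : G) (x : M), V x →ₗ[ℝ] V (g • x)
  act_one : ∀ x v, TotalSpace.mk' FV ((1 : G) • x) (act 1 x v) = TotalSpace.mk' FV x v
  act_mul : ∀ g h x v, TotalSpace.mk' FV ((g * h) • x) (act (g * h) x v) =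
    TotalSpace.mk' FV (g • h • x) (act g (h • x) (act h x v))
  contMDiff_act : ContMDiff (𝓘(ℝ, EG).prod (𝓘(ℝ, E).prod 𝓘(ℝ, FV))) (𝓘(ℝ, E).prod 𝓘(ℝ, FV)) ∞
    (fun p : G × TotalSpace FV V => TotalSpace.mk' FV (p.1 • p.2.1) (act p.1 p.2.1 p.2.2))

/-- The value `(g · e)(x) = g · e(g⁻¹ x)` of the induced action of `G` on sections, as a point of
the total space (lying over `g • g⁻¹ • x = x`). -/
def BundleAction.translate (Φ : BundleAction EG G E FV V) (e : SmoothSec E FV V) (x : M) (g : G) :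
    TotalSpace FV V :=
  TotalSpace.mk' FV (g • g⁻¹ • x) (Φ.act g (g⁻¹ • x) (e (g⁻¹ • x)))

/-- The infinitesimal action of `a ∈ 𝔤` on the section `e` induced by the action `Φ` of `G` on
the total space, i.e. `d/dt exp(t a) · e` at `t = 0`, is the section `e'`. The derivative of the map
`g ↦ (g · e)(x)` from `G` to the fibre over `x` is taken in a linear trivialization of the bundle
at `x`. -/
def BundleAction.IsInfinitesimal (Φ : BundleAction EG G E FV V) (a : LieAlg EG G)
    (e e' : SmoothSec E FV V) : Prop :=
  ∀ x : M, mvfderiv 𝓘(ℝ, EG)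
      (fun g : G => (trivializationAt FV V x (Φ.translate e x g)).2) 1 a =
    (trivializationAt FV V x (TotalSpace.mk' FV x (e' x))).2

variable {𝔞 : Type*} [AddCommGroup 𝔞] [Module ℝ 𝔞]

/-- `ρ : 𝔞 → Γ(V)` is an extension of the action of `G` on `M` to the Courant algebroid `C`:
`𝔞` is an exact Courant algebra over `𝔤`, the map `ρ` is a morphism of Courant algebras covering
the infinitesimal action, `𝔥 = ker π` acts trivially, and the induced action of `𝔤 = 𝔞 / 𝔥` on
`Γ(V)` integrates to an action of `G` on the total space of `V`. -/
structure IsExtendedAction (C : CourantAlgebroid E FV V) (A : CourantAlgebra (LieAlg EG G) 𝔞)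
    (ρ : 𝔞 →ₗ[ℝ] SmoothSec E FV V) : Prop where
  exact : A.IsExact
  map_bracket : ∀ a b, ρ (A.bracket a b) = C.bracket (ρ a) (ρ b)
  anchor_eq : ∀ a x, C.anchor x (ρ a x) = infAction E (A.proj a) x
  kernel_acts_trivially : ∀ h ∈ A.kernel, ∀ e, C.bracket (ρ h) e = 0
  integrates : ∃ Φ : BundleAction EG G E FV V,
    ∀ a e, Φ.IsInfinitesimal (A.proj a) e (C.bracket (ρ a) e)

/-- The distribution `K = ρ(𝔞) ⊆ V`, at the point `x`. -/
def imageDistribution (ρ : 𝔞 →ₗ[ℝ] SmoothSec E FV V) (x : M) : Submodule ℝ (V x) :=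
  Submodule.span ℝ (Set.range fun a => ρ a x)

/-- The extended action is isotropic: `K ⊆ K^⊥`. -/
def IsIsotropicAction (C : CourantAlgebroid E FV V) (ρ : 𝔞 →ₗ[ℝ] SmoothSec E FV V) : Prop :=
  ∀ x, ∀ v ∈ imageDistribution ρ x, ∀ w ∈ imageDistribution ρ x, C.pairing x v w = 0

variable [FiniteDimensional ℝ E] [T2Space M]

/-- The extensions `ρ` and `ρ'` of the same action by the same Courant algebra are equivalent: they
agree on `𝔥 = ker π` and `ρ'(a) - ρ(a) = 𝒟 ⟨f, π(a)⟩` for a smooth `G`-equivariant function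
`f : M → 𝔤^*`. -/
def AreEquivalentActions (C : CourantAlgebroid E FV V) (A : CourantAlgebra (LieAlg EG G) 𝔞)
    (ρ ρ' : 𝔞 →ₗ[ℝ] SmoothSec E FV V) : Prop :=
  (∀ h ∈ A.kernel, ρ' h = ρ h) ∧
  ∃ (f : M → Module.Dual ℝ (LieAlg EG G))
    (hf : ∀ a, ContMDiff 𝓘(ℝ, E) 𝓘(ℝ, ℝ) ∞ (fun x => f x a)),
    (∀ (g : G) (x : M), f (g • x) = coAd g (f x)) ∧
    ∀ a, ρ' a - ρ a = C.D ⟨fun x => f x (A.proj a), hf (A.proj a)⟩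

/-- `μ : 𝔥 → C^∞(M)` is a moment map for the extended action `ρ`: it is `𝔤`-equivariant, and
`dμ_h = ν(h)`, where `ν` is the restriction of `ρ` to `𝔥`. -/
def IsMomentMap (C : CourantAlgebroid E FV V) (A : CourantAlgebra (LieAlg EG G) 𝔞)
    (ρ : 𝔞 →ₗ[ℝ] SmoothSec E FV V) (μ : A.kernel →ₗ[ℝ] SmoothFun E M) : Prop :=
  (∀ a h x, mvfderiv 𝓘(ℝ, E) (μ h) x (infAction E (A.proj a) x) = μ (A.kernelAct a h) x) ∧
  ∀ h, C.D (μ h) = ρ h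

variable (EG G E M) in
/-- A smooth `𝔤`-equivariant function `f : M → 𝔤_ℂ^*`. Its component `f_a`, for `a ∈ 𝔤`, is the
complex function `x ↦ f(x)(1 ⊗ a)`; equivariance is `ψ(a) f_b = f_{[a, b]}`. -/
structure EquivariantFunction where
  toFun : M → Module.Dual ℂ (ℂ ⊗[ℝ] LieAlg EG G)
  contMDiff : ∀ c, ContMDiff 𝓘(ℝ, E) 𝓘(ℝ, ℂ) ∞ (fun x => toFun x c)
  equivariant : ∀ (a b : LieAlg EG G) (x : M),
    mvfderiv 𝓘(ℝ, E) (fun y => toFun y (1 ⊗ₜ[ℝ] b)) x (infAction E a x) =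
      toFun x (1 ⊗ₜ[ℝ] ⁅a, b⁆)

namespace EquivariantFunction

variable (f : EquivariantFunction EG G E M)

/-- The component `f_a`. -/
def comp (a : LieAlg EG G) : SmoothFunC E M :=
  ⟨fun x => f.toFun x (1 ⊗ₜ[ℝ] a), f.contMDiff _⟩

/-- The map `a ↦ Re f_a`. -/
def re : LieAlg EG G →ₗ[ℝ] SmoothFun E M where
  toFun a := (f.comp a).re
  map_add' a b := by
    ext x
    change (f.toFun x (1 ⊗ₜ[ℝ] (a + b))).re =
      (f.toFun x (1 ⊗ₜ[ℝ] a)).re + (f.toFun x (1 ⊗ₜ[ℝ] b)).re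
    rw [TensorProduct.tmul_add, map_add, Complex.add_re]
  map_smul' c a := by
    ext x
    change (f.toFun x (1 ⊗ₜ[ℝ] (c • a))).re = c * (f.toFun x (1 ⊗ₜ[ℝ] a)).re
    rw [TensorProduct.tmul_smul, LinearMap.map_smul_of_tower, Complex.smul_re, smul_eq_mul]

/-- The map `a ↦ Im f_a`. -/
def im : LieAlg EG G →ₗ[ℝ] SmoothFun E M where
  toFun a := (f.comp a).im
  map_add' a b := by
    ext x
    change (f.toFun x (1 ⊗ₜ[ℝ] (a + b))).im =
      (f.toFun x (1 ⊗ₜ[ℝ] a)).im + (f.toFun x (1 ⊗ₜ[ℝ] b)).im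
    rw [TensorProduct.tmul_add, map_add, Complex.add_im]
  map_smul' c a := by
    ext x
    change (f.toFun x (1 ⊗ₜ[ℝ] (c • a))).im = c * (f.toFun x (1 ⊗ₜ[ℝ] a)).im
    rw [TensorProduct.tmul_smul, LinearMap.map_smul_of_tower, Complex.smul_im, smul_eq_mul]

end EquivariantFunction

end Group

end

set_option linter.unusedSectionVars false

/-! ## Exact sections in a Courant algebroid -/

namespace CourantAlgebroid

variable {E : Type*} [NormedAddCommGroup E] [NormedSpace ℝ E]
  {M : Type*} [TopologicalSpace M] [ChartedSpace E M] [IsManifold 𝓘(ℝ, E) ∞ M]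
  {FV : Type*} [NormedAddCommGroup FV] [NormedSpace ℝ FV] [FiniteDimensional ℝ FV]
  {V : M → Type*} [TopologicalSpace (TotalSpace FV V)]
  [∀ x, AddCommGroup (V x)] [∀ x, Module ℝ (V x)] [∀ x, TopologicalSpace (V x)]
  [FiberBundle FV V] [VectorBundle ℝ FV V] [ContMDiffVectorBundle ∞ FV V 𝓘(ℝ, E)]
  (C : CourantAlgebroid E FV V)

/-! The algebra rests on three properties of exact sections: `[𝒟 u, ·] = 0` (`bracket_D_left`), `[e,
𝒟 u] = 𝒟 (π(e) u)` (`bracket_D_right_eq`), and `π(𝒟 u) = 0` by exactness. Changing `ρ(a)` by `𝒟 u_a`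
therefore alters neither the anchor nor the operator `[ρ(a), ·]`, so the same action of `G` on the
bundle integrates it, and compatibility with brackets reduces to the infinitesimal equivariance of
`u`. The same computation adjoins a second copy of `𝔤` acting by `h ↦ 𝒟 u_h`.

By the definition of `D`, removing `d(Re f_a)` from `ρ(a)` leaves `-𝒥 d(Im f_a)`. Taking `u = Im f`
on the second copy, `K` is spanned by the `𝒥 d(Im f_g)` and the `d(Im f_h)`, two families that `𝒥`
exchanges up to sign.

The analytic point is that equivalence asks for equivariance under `G`, while `f` is only
`𝔤`-equivariant. Along `k ↦ u_{Ad k c}(k · x)` the derivative at `1` vanishes, because the variation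
of `Ad k` contributes `u_{[a,c]}` and the motion of the point contributes `-u_{[a,c]}`. Translation
extends this to every `k`, and connectedness gives `apply_smul_eq_of_infinitesimal`. The input is
`d(Ad)_1 = ad` for the bracket of left-invariant fields (`mvfderiv_adCLM_apply`), obtained from the
second derivative of the multiplication in a chart. -/

lemma pairing_coDiff (f : M → ℝ) (x : M) (v : V x) :
    C.pairing x (C.coDiff f x) v = (1 / 2 : ℝ) * mvfderiv 𝓘(ℝ, E) f x (C.anchor x v) := by
  rw [AnchoredMetricBundle.coDiff, map_smul, LinearMap.smul_apply, smul_eq_mul]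
  congr 1
  exact C.pairing_sharp x _ v

/-- The Leibniz rule in the first argument of the bracket. -/
lemma funSmul_bracket (f : SmoothFun E M) (s t : SmoothSec E FV V) (x : M) :
    C.bracket (funSmul f s) t x = f x • C.bracket s t x
      - (mvfderiv 𝓘(ℝ, E) f x (C.anchorField t x)) • s x
      + (2 * C.pairing x (s x) (t x)) • C.coDiff f x := by
  have md : ∀ f : SmoothFun E M, MDifferentiableAt 𝓘(ℝ, E) 𝓘(ℝ, ℝ) f x := fun f =>
    f.contMDiff.mdifferentiable (by simp) x
  have hfu : (C.pair (funSmul f s) t : M → ℝ) = (f : M → ℝ) * C.pair s t := by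
    funext y
    change C.pairing y (f y • s y) (t y) = f y * C.pairing y (s y) (t y)
    simp
  -- The symmetrisation formula for `⟨f s, t⟩` transfers the Leibniz rule from the second argument
  -- to the first.
  have h1 := C.coDiff_pair (funSmul f s) t x
  have h2 := C.coDiff_pair s t x
  rw [hfu, C.coDiff_mul (md f) (md _), h2, C.bracket_funSmul] at h1
  have h3 : (C.pair s t) x = C.pairing x (s x) (t x) := rfl
  rw [h3] at h1
  linear_combination (norm := module) (-2 : ℝ) • h1

variable [FiniteDimensional ℝ E] [T2Space M]

@[simp]
lemma D_apply (f : SmoothFun E M) (x : M) : C.D f x = C.coDiff f x := rfl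

lemma pair_D_apply (f : SmoothFun E M) (s : SmoothSec E FV V) (x : M) :
    C.pair s (C.D f) x = (1 / 2 : ℝ) * mvfderiv 𝓘(ℝ, E) f x (C.anchor x (s x)) := by
  change C.pairing x (s x) (C.coDiff f x) = _
  rw [C.pairing_symm, pairing_coDiff]

lemma D_pair (s t : SmoothSec E FV V) :
    C.D (C.pair s t) = (1 / 2 : ℝ) • (C.bracket s t + C.bracket t s) := by
  ext x
  exact C.coDiff_pair s t x

/-- `𝒟⟨s, t⟩` is half of `[s, t] + [t, s]`, and the Jacobi identities for `(s, t, e)` and `(t, s,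
e)` add up to the vanishing of its bracket with `e`. -/
lemma bracket_D_pair_left (s t e : SmoothSec E FV V) : C.bracket (C.D (C.pair s t)) e = 0 := by
  rw [D_pair, map_smul, map_add, LinearMap.smul_apply, LinearMap.add_apply]
  have h1 := C.bracket_bracket s t e
  have h2 := C.bracket_bracket t s e
  have : C.bracket (C.bracket s t) e + C.bracket (C.bracket t s) e = 0 := by
    rw [h2] at h1
    rw [← sub_eq_zero] at h1
    rw [← neg_eq_zero, ← h1]
    abel
  rw [this, smul_zero]

/-- Exact sections act trivially from the left. -/
lemma bracket_D_left (f : SmoothFun E M) (e : SmoothSec E FV V) : C.bracket (C.D f) e = 0 := by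
  ext x
  -- Either nondegeneracy makes the fibre zero, or some `u = ⟨s, t⟩` is nonzero at `x`. In the
  -- second case `𝒟⟨f s, t⟩ = f 𝒟u + u 𝒟f` reduces the claim to sections of the form `𝒟⟨·, ·⟩`.
  by_cases hv : ∀ v w : V x, C.pairing x v w = 0
  · exact (C.pairing_nondegenerate x).1 _ (hv _)
  push Not at hv
  obtain ⟨v, w, hvw⟩ := hv
  obtain ⟨s, rfl⟩ := exists_section_eq (E := E) (FV := FV) x v
  obtain ⟨t, rfl⟩ := exists_section_eq (E := E) (FV := FV) x w
  have md : ∀ (f : SmoothFun E M) (y : M), MDifferentiableAt 𝓘(ℝ, E) 𝓘(ℝ, ℝ) f y := fun f y =>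
    f.contMDiff.mdifferentiable (by simp) y
  set u := C.pair s t with hu
  have hux : u x ≠ 0 := hvw
  have hD : C.D (C.pair (funSmul f s) t) = funSmul f (C.D u) + funSmul u (C.D f) := by
    have hfu : (C.pair (funSmul f s) t : M → ℝ) = (f : M → ℝ) * u := by
      funext y
      change C.pairing y (f y • s y) (t y) = f y * C.pairing y (s y) (t y)
      simp
    ext y
    change C.coDiff (C.pair (funSmul f s) t) y = f y • C.coDiff u y + u y • C.coDiff f y
    rw [hfu, C.coDiff_mul (md f y) (md u y)]
  have h := congrArg (fun s : SmoothSec E FV V => s x) (C.bracket_D_pair_left (funSmul f s) t e)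
  have h0 : C.bracket (C.D u) e x = 0 := by
    rw [hu, C.bracket_D_pair_left]
    rfl
  have ha : ∀ g : M → ℝ, mvfderiv 𝓘(ℝ, E) g x (C.anchorField e x) =
      mvfderiv 𝓘(ℝ, E) g x (C.anchor x (e x)) := fun _ => rfl
  -- The derivative terms from `[f 𝒟u, e]` and `[u 𝒟f, e]` cancel in pairs, leaving `u [𝒟f, e] = 0`
  -- at `x`.
  simp only [hD, map_add, LinearMap.add_apply, ContMDiffSection.coe_add, Pi.add_apply,
    funSmul_bracket, D_apply, pairing_coDiff, ha, h0, ContMDiffSection.coe_zero,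
    Pi.zero_apply] at h
  have h' : u x • C.bracket (C.D f) e x = 0 := by
    linear_combination (norm := module) (1 : ℝ) • h
  exact (smul_eq_zero.mp h').resolve_left hux

/-- One of the two terms in the symmetrised bracket of `e` and `𝒟 f` is zero, so the other is
determined. -/
lemma bracket_D_right (e : SmoothSec E FV V) (f : SmoothFun E M) :
    C.bracket e (C.D f) = (2 : ℝ) • C.D (C.pair e (C.D f)) := by
  rw [D_pair, bracket_D_left, add_zero, smul_smul]
  norm_num

/-- `[e, 𝒟 f] = 𝒟 (π(e) f)`. -/
lemma bracket_D_right_eq {e : SmoothSec E FV V} {f g : SmoothFun E M}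
    (h : ∀ x, mvfderiv 𝓘(ℝ, E) f x (C.anchor x (e x)) = g x) :
    C.bracket e (C.D f) = C.D g := by
  rw [bracket_D_right, ← map_smul]
  congr 1
  ext x
  change 2 * C.pair e (C.D f) x = g x
  rw [pair_D_apply, h]
  ring

lemma IsExact.anchor_D (hC : C.IsExact) (f : SmoothFun E M) (x : M) :
    C.anchor x (C.D f x) = 0 := by
  rw [D_apply, AnchoredMetricBundle.coDiff, map_smul, (hC x).2.1.apply_apply_eq_zero, smul_zero]

end CourantAlgebroid

/-! ## The adjoint representation -/

section Adjoint

variable {EG : Type*} [NormedAddCommGroup EG] [NormedSpace ℝ EG] [FiniteDimensional ℝ EG]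
  {G : Type*} [TopologicalSpace G] [ChartedSpace EG G] [Group G] [LieGroup 𝓘(ℝ, EG) ∞ G]

/-- The adjoint action as a continuous linear endomorphism of the model space. -/
noncomputable def adCLM (g : G) : EG →L[ℝ] EG :=
  mfderiv 𝓘(ℝ, EG) 𝓘(ℝ, EG) (fun h : G => g * h * g⁻¹) 1

lemma contMDiff_conj :
    ContMDiff (𝓘(ℝ, EG).prod 𝓘(ℝ, EG)) 𝓘(ℝ, EG) ∞ (fun p : G × G => p.1 * p.2 * p.1⁻¹) :=
  (contMDiff_fst.mul contMDiff_snd).mul contMDiff_fst.inv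

lemma contMDiff_conj_right (g : G) :
    ContMDiff 𝓘(ℝ, EG) 𝓘(ℝ, EG) ∞ (fun h : G => g * h * g⁻¹) :=
  (contMDiff_const.mul contMDiff_id).mul contMDiff_const

/-- With fixed base points the changes of tangent coordinates are identities. The map `q` is only
propositionally constant, as for `g ↦ g * 1 * g⁻¹`. -/
lemma inTangentCoordinates_const {N : Type*} (x y : G) {q : N → G} (hq : ∀ n, q n = y)
    (L : N → EG →L[ℝ] EG) (n₀ n : N) :
    inTangentCoordinates 𝓘(ℝ, EG) 𝓘(ℝ, EG) (fun _ => x) q L n₀ n = L n := by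
  obtain rfl : q = fun _ => y := funext hq
  rw [inTangentCoordinates_eq _ _ _ (by simp) (by simp)]
  ext v
  simp only [ContinuousLinearMap.coe_comp, Function.comp_apply]
  rw [(tangentBundleCore 𝓘(ℝ, EG) G).coordChange_self _ _ (by simp),
    (tangentBundleCore 𝓘(ℝ, EG) G).coordChange_self _ _ (by simp)]

/-- Conjugation is jointly smooth, so its derivative in the second variable depends smoothly on the
parameter. -/
lemma contMDiff_adCLM :
    ContMDiff 𝓘(ℝ, EG) 𝓘(ℝ, EG →L[ℝ] EG) ∞ (adCLM (EG := EG) (G := G)) := by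
  have : IsManifold 𝓘(ℝ, EG) 1 G := IsManifold.of_le (n := ∞) (by simp)
  intro g₀
  have h := ContMDiffAt.mfderiv (I := 𝓘(ℝ, EG)) (I' := 𝓘(ℝ, EG)) (J := 𝓘(ℝ, EG)) (x₀ := g₀)
    (m := ∞) (n := ∞)
    (fun g h : G => g * h * g⁻¹) (fun _ => 1) contMDiff_conj.contMDiffAt contMDiffAt_const
    (by simp)
  refine h.congr_of_eventuallyEq (Eventually.of_forall fun g => ?_)
  exact (inTangentCoordinates_const 1 1 (q := fun g : G => g * 1 * g⁻¹) (by simp) adCLM g₀ g).symm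

lemma adCLM_one : adCLM (EG := EG) (1 : G) = ContinuousLinearMap.id ℝ EG := by
  have : (fun h : G => 1 * h * 1⁻¹) = id := by ext; simp
  unfold adCLM
  rw [this]
  exact mfderiv_id

lemma adCLM_mul (g h : G) (c : EG) :
    adCLM (EG := EG) (g * h) c = adCLM (EG := EG) g (adCLM (EG := EG) h c) := by
  have : (fun k : G => g * h * k * (g * h)⁻¹) =
      (fun k : G => g * k * g⁻¹) ∘ (fun k : G => h * k * h⁻¹) := by
    ext; simp [mul_assoc]
  have md : ∀ g k : G, MDifferentiableAt 𝓘(ℝ, EG) 𝓘(ℝ, EG) (fun h : G => g * h * g⁻¹) k :=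
    fun g k => (contMDiff_conj_right g).mdifferentiable (by simp) k
  unfold adCLM
  rw [this, mfderiv_comp_of_eq (y := 1) (md _ _) (md _ _) (by simp)]
  -- The chain rule produces the derivative at `h * 1 * h⁻¹`, which must be moved to `1`.
  have hp := mfderiv_congr_point (I := 𝓘(ℝ, EG)) (I' := 𝓘(ℝ, EG)) (f := fun k : G => g * k * g⁻¹)
    (show h * 1 * h⁻¹ = 1 by simp)
  exact DFunLike.congr_fun hp _

/-! ### Multiplication in a chart at the identity -/

variable (EG G) in
/-- The multiplication of `G` in the chart at `1`. -/
noncomputable def chartMul (p : EG × EG) : EG :=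
  extChartAt 𝓘(ℝ, EG) (1 : G)
    ((extChartAt 𝓘(ℝ, EG) (1 : G)).symm p.1 * (extChartAt 𝓘(ℝ, EG) (1 : G)).symm p.2)

variable (EG G) in
/-- The coordinates of `1` in the chart at `1`. -/
noncomputable def chartOne : EG := extChartAt 𝓘(ℝ, EG) (1 : G) 1

lemma chartSymm_chartOne : (extChartAt 𝓘(ℝ, EG) (1 : G)).symm (chartOne EG G) = 1 :=
  extChartAt_to_inv _

lemma contMDiffAt_chartSymm :
    ContMDiffAt 𝓘(ℝ, EG) 𝓘(ℝ, EG) ∞ (extChartAt 𝓘(ℝ, EG) (1 : G)).symm (chartOne EG G) := by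
  have := contMDiffOn_extChartAt_symm (I := 𝓘(ℝ, EG)) (n := ∞) (1 : G)
  exact this.contMDiffAt (extChartAt_target_mem_nhds _)

lemma contDiffAt_chartMul : ContDiffAt ℝ ∞ (chartMul EG G) (chartOne EG G, chartOne EG G) := by
  rw [← contMDiffAt_iff_contDiffAt]
  have h1 : ContMDiffAt 𝓘(ℝ, EG × EG) 𝓘(ℝ, EG) ∞
      (fun p : EG × EG => (extChartAt 𝓘(ℝ, EG) (1 : G)).symm p.1)
      (chartOne EG G, chartOne EG G) :=
    contMDiffAt_chartSymm.comp (chartOne EG G, chartOne EG G) contDiff_fst.contMDiff.contMDiffAt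
  have h2 : ContMDiffAt 𝓘(ℝ, EG × EG) 𝓘(ℝ, EG) ∞
      (fun p : EG × EG => (extChartAt 𝓘(ℝ, EG) (1 : G)).symm p.2)
      (chartOne EG G, chartOne EG G) :=
    contMDiffAt_chartSymm.comp (chartOne EG G, chartOne EG G) contDiff_snd.contMDiff.contMDiffAt
  refine ContMDiffAt.comp_of_eq (y := (1 : G)) (contMDiffAt_extChartAt (x := (1 : G))) (h1.mul h2) ?_
  simp only [chartSymm_chartOne, mul_one]

lemma chartSymm_mem_nhds {U : Set G} (hU : U ∈ 𝓝 (1 : G)) :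
    ∀ᶠ x in 𝓝 (chartOne EG G), (extChartAt 𝓘(ℝ, EG) (1 : G)).symm x ∈ U :=
  (contMDiffAt_chartSymm (EG := EG) (G := G)).continuousAt.preimage_mem_nhds
    (by rwa [chartSymm_chartOne])

lemma chartMul_one_right :
    ∀ᶠ x in 𝓝 (chartOne EG G), chartMul EG G (x, chartOne EG G) = x := by
  filter_upwards [extChartAt_target_mem_nhds (I := 𝓘(ℝ, EG)) (1 : G)] with x hx
  simp only [chartMul, chartSymm_chartOne, mul_one]
  exact (extChartAt 𝓘(ℝ, EG) (1 : G)).right_inv hx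

lemma chartMul_one_left :
    ∀ᶠ x in 𝓝 (chartOne EG G), chartMul EG G (chartOne EG G, x) = x := by
  filter_upwards [extChartAt_target_mem_nhds (I := 𝓘(ℝ, EG)) (1 : G)] with x hx
  simp only [chartMul, chartSymm_chartOne, one_mul]
  exact (extChartAt 𝓘(ℝ, EG) (1 : G)).right_inv hx

lemma differentiableAt_chartMul :
    DifferentiableAt ℝ (chartMul EG G) (chartOne EG G, chartOne EG G) :=
  contDiffAt_chartMul.differentiableAt (by simp)

/-- Each partial map obtained by fixing one factor at the identity is locally the identity map. -/
lemma fderiv_chartMul_one (u v : EG) :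
    fderiv ℝ (chartMul EG G) (chartOne EG G, chartOne EG G) (u, v) = u + v := by
  have h1 : fderiv ℝ (chartMul EG G) (chartOne EG G, chartOne EG G) (u, 0) = u := by
    have h : HasFDerivAt (fun x => chartMul EG G (x, chartOne EG G)) _ (chartOne EG G) :=
      HasFDerivAt.comp (g := chartMul EG G) _ differentiableAt_chartMul.hasFDerivAt
        (hasFDerivAt_prodMk_left (chartOne EG G) (chartOne EG G))
    have h' := (hasFDerivAt_id (𝕜 := ℝ) (chartOne EG G)).congr_of_eventuallyEq
      (chartMul_one_right (EG := EG) (G := G))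
    simpa using! congrArg (fun L : EG →L[ℝ] EG => L u) (h.unique h')
  have h2 : fderiv ℝ (chartMul EG G) (chartOne EG G, chartOne EG G) (0, v) = v := by
    have h : HasFDerivAt (fun x => chartMul EG G (chartOne EG G, x)) _ (chartOne EG G) :=
      HasFDerivAt.comp (g := chartMul EG G) _ differentiableAt_chartMul.hasFDerivAt
        (hasFDerivAt_prodMk_right (chartOne EG G) (chartOne EG G))
    have h' := (hasFDerivAt_id (𝕜 := ℝ) (chartOne EG G)).congr_of_eventuallyEq
      (chartMul_one_left (EG := EG) (G := G))
    simpa using! congrArg (fun L : EG →L[ℝ] EG => L v) (h.unique h')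
  rw [show (u, v) = (u, 0) + (0, v) by simp, map_add, h1, h2]

lemma eventually_differentiableAt_chartMul :
    ∀ᶠ p in 𝓝 (chartOne EG G, chartOne EG G), DifferentiableAt ℝ (chartMul EG G) p := by
  -- The order is lowered to `1` because `ContDiffAt` at a point spreads to a neighbourhood only for
  -- orders other than `∞`.
  have h : ContDiffAt ℝ 1 (chartMul EG G) (chartOne EG G, chartOne EG G) :=
    contDiffAt_chartMul.of_le (by simp)
  filter_upwards [h.eventually (by simp)] with p hp
  exact hp.differentiableAt (by simp)

lemma hasFDerivAt_fderiv_chartMul :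
    HasFDerivAt (fderiv ℝ (chartMul EG G))
      (fderiv ℝ (fderiv ℝ (chartMul EG G)) (chartOne EG G, chartOne EG G))
      (chartOne EG G, chartOne EG G) :=
  ((contDiffAt_chartMul.fderiv_right (m := ∞) (by simp)).differentiableAt (by simp)).hasFDerivAt

/-- A left-invariant vector field in the chart at `1`. -/
lemma mpullback_mulInvariantVectorField_chart (a : LieAlg EG G) :
    ∀ᶠ x in 𝓝 (chartOne EG G),
      VectorField.mpullbackWithin 𝓘(ℝ, EG) 𝓘(ℝ, EG) (extChartAt 𝓘(ℝ, EG) (1 : G)).symm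
        (mulInvariantVectorField a) (range 𝓘(ℝ, EG)) x =
      fderiv ℝ (chartMul EG G) (x, chartOne EG G) ((0 : EG), (a : EG)) := by
  have : IsManifold 𝓘(ℝ, EG) 1 G := IsManifold.of_le (n := ∞) (by simp)
  have hc : ContinuousAt (fun x : EG => (x, chartOne EG G)) (chartOne EG G) := by fun_prop
  filter_upwards [extChartAt_target_mem_nhds (I := 𝓘(ℝ, EG)) (1 : G),
    hc.eventually eventually_differentiableAt_chartMul] with x hx hd
  set φ := extChartAt 𝓘(ℝ, EG) (1 : G) with hφ
  have hinv : (mfderivWithin 𝓘(ℝ, EG) 𝓘(ℝ, EG) φ.symm (range 𝓘(ℝ, EG)) x).inverse =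
      mfderiv 𝓘(ℝ, EG) 𝓘(ℝ, EG) φ (φ.symm x) :=
    ContinuousLinearMap.inverse_eq (mfderivWithin_extChartAt_symm_comp_mfderiv_extChartAt hx)
      (mfderiv_extChartAt_comp_mfderivWithin_extChartAt_symm hx)
  have hxs : φ.symm x ∈ φ.source := φ.map_target hx
  have h1 : MDifferentiableAt 𝓘(ℝ, EG) 𝓘(ℝ, EG) φ (φ.symm x) :=
    mdifferentiableAt_extChartAt (by simpa [hφ] using hxs)
  have h2 : MDifferentiableAt 𝓘(ℝ, EG) 𝓘(ℝ, EG) (fun h : G => φ.symm x * h) 1 :=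
    (contMDiff_mul_left (I := 𝓘(ℝ, EG)) (n := ∞)).mdifferentiable (by simp) 1
  have h3 := mfderiv_comp_apply_of_eq (y := φ.symm x) 1 h1 h2 (mul_one _) a
  have h4 : MDifferentiableAt 𝓘(ℝ, EG) 𝓘(ℝ, EG) (φ ∘ fun h : G => φ.symm x * h) 1 :=
    h1.comp_of_eq 1 h2 (mul_one _)
  have h5 : HasFDerivAt (fun y => chartMul EG G (x, y)) _ (chartOne EG G) :=
    HasFDerivAt.comp (g := chartMul EG G) _ hd.hasFDerivAt
      (hasFDerivAt_prodMk_right x (chartOne EG G))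
  -- The manifold derivative at `1` is by definition taken in the chart at `1`, so no change of
  -- coordinates appears.
  have h6 : HasFDerivAt (fun y => chartMul EG G (x, y))
      (mfderiv 𝓘(ℝ, EG) 𝓘(ℝ, EG) (φ ∘ fun h : G => φ.symm x * h) 1) (chartOne EG G) :=
    hasFDerivWithinAt_univ.mp (by simpa using! h4.hasMFDerivAt.2)
  have h7 := congrArg (fun L : EG →L[ℝ] EG => L a) (HasFDerivAt.unique (E := EG) (F := EG) h6 h5)
  rw [VectorField.mpullbackWithin_apply, hinv]
  exact h3.symm.trans h7

lemma fderiv_fderiv_chartMul_comm (p q : EG × EG) :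
    fderiv ℝ (fderiv ℝ (chartMul EG G)) (chartOne EG G, chartOne EG G) p q =
      fderiv ℝ (fderiv ℝ (chartMul EG G)) (chartOne EG G, chartOne EG G) q p :=
  (contDiffAt_chartMul.isSymmSndFDerivAt (by simpa using ENat.LEInfty.out)) p q

lemma hasFDerivAt_fderiv_chartMul_left (u : EG × EG) :
    HasFDerivAt (fun x => fderiv ℝ (chartMul EG G) (x, chartOne EG G) u)
      (((ContinuousLinearMap.apply ℝ EG u) ∘L
        fderiv ℝ (fderiv ℝ (chartMul EG G)) (chartOne EG G, chartOne EG G)) ∘L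
          ContinuousLinearMap.inl ℝ EG EG) (chartOne EG G) :=
  HasFDerivAt.comp (g := fun p => fderiv ℝ (chartMul EG G) p u) _
    ((ContinuousLinearMap.apply ℝ EG u).hasFDerivAt.comp _ hasFDerivAt_fderiv_chartMul)
    (hasFDerivAt_prodMk_left (chartOne EG G) (chartOne EG G))

/-! ### The Lie bracket and the derivative of the adjoint action -/

variable (EG G) in
/-- The Lie bracket of `𝔤`, as an operation on the model space. -/
noncomputable def modelLie (a c : EG) : EG := @Bracket.bracket (LieAlg EG G) (LieAlg EG G) _ a c

/-- The Lie bracket in terms of the second derivative of the multiplication. -/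
lemma modelLie_eq (a c : EG) :
    modelLie EG G a c =
      fderiv ℝ (fderiv ℝ (chartMul EG G)) (chartOne EG G, chartOne EG G) (a, 0) (0, c) -
        fderiv ℝ (fderiv ℝ (chartMul EG G)) (chartOne EG G, chartOne EG G) (c, 0) (0, a) := by
  have : IsManifold 𝓘(ℝ, EG) 1 G := IsManifold.of_le (n := ∞) (by simp)
  let W : EG → EG → EG := fun a =>
    VectorField.mpullbackWithin 𝓘(ℝ, EG) 𝓘(ℝ, EG) (extChartAt 𝓘(ℝ, EG) (1 : G)).symm
      (mulInvariantVectorField a) (range 𝓘(ℝ, EG))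
  have hW : ∀ a : EG, HasFDerivAt (W a) _ (chartOne EG G) := fun a =>
    (hasFDerivAt_fderiv_chartMul_left ((0 : EG), a)).congr_of_eventuallyEq
      (mpullback_mulInvariantVectorField_chart a)
  have hv : ∀ a : EG, W a (chartOne EG G) = a := fun a =>
    (mpullback_mulInvariantVectorField_chart a).self_of_nhds.trans
      ((fderiv_chartMul_one (G := G) 0 a).trans (zero_add a))
  have h : modelLie EG G a c = VectorField.lieBracketWithin ℝ (W a) (W c) univ (chartOne EG G) := by
    -- The chart has identity derivative at its own centre, so the manifold bracket at `1` is the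
    -- bracket of the chart representatives.
    have hid : (mfderiv 𝓘(ℝ, EG) 𝓘(ℝ, EG) (extChartAt 𝓘(ℝ, EG) (1 : G)) 1).inverse =
        ContinuousLinearMap.id ℝ (TangentSpace 𝓘(ℝ, EG) (1 : G)) := by
      rw [mfderiv_extChartAt_self]
      exact ContinuousLinearMap.inverse_id
    have hs : (extChartAt 𝓘(ℝ, EG) (1 : G)).symm ⁻¹' univ ∩ range 𝓘(ℝ, EG) = univ := by simp
    exact (DFunLike.congr_fun hid _).trans
      (congrArg (fun s => VectorField.lieBracketWithin ℝ (W a) (W c) s (chartOne EG G)) hs)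
  rw [h, VectorField.lieBracketWithin_univ, VectorField.lieBracket, hv, hv, (hW a).fderiv,
    (hW c).fderiv]
  rfl

/-- The adjoint action in the chart at `1`. -/
noncomputable def chartAd (x : EG) : EG →L[ℝ] EG := adCLM ((extChartAt 𝓘(ℝ, EG) (1 : G)).symm x)

lemma differentiableAt_chartAd : DifferentiableAt ℝ (chartAd (G := G)) (chartOne EG G) := by
  have h : ContMDiffAt 𝓘(ℝ, EG) 𝓘(ℝ, EG →L[ℝ] EG) ∞ (chartAd (G := G)) (chartOne EG G) :=
    contMDiff_adCLM.contMDiffAt.comp _ contMDiffAt_chartSymm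
  exact h.contDiffAt.differentiableAt (by simp)

/-- This is the derivative in `y`, at the identity, of `x y = (x y x⁻¹) x`. -/
lemma fderiv_chartMul_chartAd (c : EG) : ∀ᶠ x in 𝓝 (chartOne EG G),
    fderiv ℝ (chartMul EG G) (x, chartOne EG G) (0, c) =
      fderiv ℝ (chartMul EG G) (chartOne EG G, x) (chartAd (G := G) x c, 0) := by
  have hc : ContinuousAt (fun x : EG => (x, chartOne EG G)) (chartOne EG G) := by fun_prop
  have hc' : ContinuousAt (fun x : EG => (chartOne EG G, x)) (chartOne EG G) := by fun_prop
  filter_upwards [extChartAt_target_mem_nhds (I := 𝓘(ℝ, EG)) (1 : G),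
    hc.eventually eventually_differentiableAt_chartMul,
    hc'.eventually eventually_differentiableAt_chartMul] with x hx hd hd'
  set φ := extChartAt 𝓘(ℝ, EG) (1 : G) with hφ
  let k : EG → EG := fun y => φ (φ.symm x * φ.symm y * (φ.symm x)⁻¹)
  have hk1 : k (chartOne EG G) = chartOne EG G := by
    simp only [k, hφ, chartSymm_chartOne, mul_one, mul_inv_cancel]
    rfl
  have hk : HasFDerivAt k (chartAd (G := G) x) (chartOne EG G) := by
    have := ((contMDiff_conj_right (EG := EG) (φ.symm x)).mdifferentiable (by simp) 1).hasMFDerivAt.2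
    simp only [writtenInExtChartAt, mul_one, mul_inv_cancel, modelWithCornersSelf_coe,
      range_id] at this
    exact hasFDerivWithinAt_univ.mp this
  have hkc : ∀ᶠ y in 𝓝 (chartOne EG G), φ.symm x * φ.symm y * (φ.symm x)⁻¹ ∈ φ.source := by
    have h : ContinuousAt (fun h : G => φ.symm x * h * (φ.symm x)⁻¹) 1 :=
      (contMDiff_conj_right (EG := EG) (φ.symm x)).continuous.continuousAt
    exact chartSymm_mem_nhds (h.preimage_mem_nhds
      (by simpa [hφ] using extChartAt_source_mem_nhds (I := 𝓘(ℝ, EG)) (1 : G)))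
  have hmul : (fun y => chartMul EG G (x, y)) =ᶠ[𝓝 (chartOne EG G)]
      fun y => chartMul EG G (k y, x) := by
    filter_upwards [hkc] with y hy
    simp only [chartMul, k, ← hφ, φ.left_inv hy, inv_mul_cancel_right]
  have h1 : HasFDerivAt (fun y => chartMul EG G (x, y)) _ (chartOne EG G) :=
    HasFDerivAt.comp (g := chartMul EG G) _ hd.hasFDerivAt
      (hasFDerivAt_prodMk_right x (chartOne EG G))
  have h2 : HasFDerivAt (fun y => chartMul EG G (k y, x)) _ (chartOne EG G) :=
    HasFDerivAt.comp (g := chartMul EG G) _ (by rw [hk1]; exact hd'.hasFDerivAt)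
      (hk.prodMk (hasFDerivAt_const x _))
  simpa using DFunLike.congr_fun (h1.unique (h2.congr_of_eventuallyEq hmul)) c

/-- Write `m` for the multiplication in the chart. Differentiating `fderiv_chartMul_chartAd` at the
identity in direction `a` gives `D²m(a,0)(0,c) = D²m(0,a)(c,0) + (d Ad)(a) c`. Symmetry of `D²m`
turns the difference into the formula of `modelLie_eq`. -/
lemma fderiv_chartAd (a c : EG) :
    fderiv ℝ (chartAd (G := G)) (chartOne EG G) a c = modelLie EG G a c := by
  rw [modelLie_eq]
  have hA : HasFDerivAt (fun x => (chartAd (G := G) x c, (0 : EG))) _ (chartOne EG G) :=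
    (differentiableAt_chartAd.hasFDerivAt.clm_apply (hasFDerivAt_const c _)).prodMk
      (hasFDerivAt_const (0 : EG) _)
  have hm : HasFDerivAt (fun x => fderiv ℝ (chartMul EG G) (chartOne EG G, x)) _ (chartOne EG G) :=
    HasFDerivAt.comp (g := fderiv ℝ (chartMul EG G)) _ hasFDerivAt_fderiv_chartMul
      (hasFDerivAt_prodMk_right (chartOne EG G) (chartOne EG G))
  have h1 := (hm.clm_apply hA).congr_of_eventuallyEq (fderiv_chartMul_chartAd (G := G) c)
  have h2 := DFunLike.congr_fun
    (h1.unique (hasFDerivAt_fderiv_chartMul_left ((0 : EG), c))) a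
  have h3 : chartAd (G := G) (chartOne EG G) = ContinuousLinearMap.id ℝ EG := by
    rw [chartAd, chartSymm_chartOne, adCLM_one]
  simp only [ContinuousLinearMap.comp_zero, zero_add, _root_.add_apply,
    ContinuousLinearMap.comp_apply, ContinuousLinearMap.prod_apply,
    ContinuousLinearMap.flip_apply, _root_.zero_apply, fderiv_chartMul_one, add_zero,
    h3, ContinuousLinearMap.id_apply, ContinuousLinearMap.inr_apply,
    ContinuousLinearMap.inl_apply, ContinuousLinearMap.apply_apply] at h2
  rw [fderiv_fderiv_chartMul_comm (c, 0), ← h2, add_sub_cancel_right]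

/-- The derivative of the adjoint action is the Lie bracket. -/
lemma mvfderiv_adCLM_apply (a c : EG) :
    mvfderiv 𝓘(ℝ, EG) (fun g : G => adCLM (EG := EG) g c) 1 a = modelLie EG G a c := by
  have h : MDifferentiableAt 𝓘(ℝ, EG) 𝓘(ℝ, EG) (fun g : G => adCLM (EG := EG) g c) 1 := by
    have := (ContinuousLinearMap.apply ℝ EG c).contDiff.contMDiff.comp (contMDiff_adCLM (EG := EG) (G := G))
    exact this.mdifferentiable (by simp) 1
  have h1 := h.hasMFDerivAt.2
  simp only [writtenInExtChartAt, modelWithCornersSelf_coe, range_id] at h1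
  have h2 : HasFDerivAt (fun x => chartAd (G := G) x c) _ (chartOne EG G) :=
    differentiableAt_chartAd.hasFDerivAt.clm_apply (hasFDerivAt_const c _)
  have h3 := congrArg (fun L : EG →L[ℝ] EG => L a) 
    (HasFDerivAt.unique (E := EG) (F := EG) (hasFDerivWithinAt_univ.mp h1) h2)
  refine Eq.trans h3 ?_
  simp [fderiv_chartAd]

end Adjoint

/-! ## Equivariance under a connected group from infinitesimal equivariance -/

section Equivariance

lemma mvfderiv_clm_comp {E M F F' : Type*} [NormedAddCommGroup E] [NormedSpace ℝ E]
    [TopologicalSpace M] [ChartedSpace E M] [NormedAddCommGroup F] [NormedSpace ℝ F]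
    [NormedAddCommGroup F'] [NormedSpace ℝ F'] (L : F →L[ℝ] F') {w : M → F} {x : M}
    (hw : MDifferentiableAt 𝓘(ℝ, E) 𝓘(ℝ, F) w x) (v : TangentSpace 𝓘(ℝ, E) x) :
    mvfderiv 𝓘(ℝ, E) (fun y => L (w y)) x v = L (mvfderiv 𝓘(ℝ, E) w x v) :=
  DFunLike.congr_fun (L.hasMFDerivAt.comp x hw.hasMFDerivAt).mfderiv v

/-- A function with zero derivative on a connected manifold is constant. -/
lemma eq_of_mvfderiv_eq_zero {E N : Type*} [NormedAddCommGroup E] [NormedSpace ℝ E]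
    [TopologicalSpace N] [ChartedSpace E N] [IsManifold 𝓘(ℝ, E) 1 N] [PreconnectedSpace N]
    {u : N → ℝ} (hu : MDifferentiable 𝓘(ℝ, E) 𝓘(ℝ, ℝ) u)
    (h : ∀ x, mvfderiv 𝓘(ℝ, E) u x = 0) (x y : N) : u x = u y := by
  -- Local constancy is checked on a ball contained in the chart target, where the derivative in
  -- coordinates is zero.
  have hloc : IsLocallyConstant u := by
    rw [IsLocallyConstant.iff_eventually_eq]
    intro x
    set φ := extChartAt 𝓘(ℝ, E) x
    obtain ⟨r, hr, hB⟩ := Metric.mem_nhds_iff.mp (extChartAt_target_mem_nhds (I := 𝓘(ℝ, E)) x)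
    have hd : ∀ z ∈ Metric.ball (φ x) r, HasFDerivAt (u ∘ φ.symm) (0 : E →L[ℝ] ℝ) z := by
      intro z hz
      have hs : MDifferentiableAt 𝓘(ℝ, E) 𝓘(ℝ, E) φ.symm z := by
        have := mdifferentiableWithinAt_extChartAt_symm (I := 𝓘(ℝ, E)) (hB hz)
        rwa [ModelWithCorners.range_eq_univ, mdifferentiableWithinAt_univ] at this
      have hc := (hu (φ.symm z)).hasMFDerivAt.comp z hs.hasMFDerivAt
      have h0 : (mfderiv 𝓘(ℝ, E) 𝓘(ℝ, ℝ) u (φ.symm z)) = 0 := h (φ.symm z)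
      rw [h0, ContinuousLinearMap.zero_comp] at hc
      exact hasMFDerivAt_iff_hasFDerivAt.mp hc
    have hc : ∀ᶠ y in 𝓝 x, φ y ∈ Metric.ball (φ x) r :=
      (continuousAt_extChartAt x).eventually (Metric.ball_mem_nhds _ hr)
    filter_upwards [hc, extChartAt_source_mem_nhds (I := 𝓘(ℝ, E)) x] with y hy hys
    have := Metric.isOpen_ball.is_const_of_fderiv_eq_zero (𝕜 := ℝ)
      (convex_ball (φ x) r).isPreconnected
      (fun z hz => (hd z hz).differentiableAt.differentiableWithinAt)
      (fun z hz => (hd z hz).fderiv) hy (Metric.mem_ball_self hr)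
    simpa [φ.left_inv hys, φ.left_inv (mem_extChartAt_source x)] using! this
  exact hloc.apply_eq_of_isPreconnected isPreconnected_univ (mem_univ x) (mem_univ y)

variable {EG : Type*} [NormedAddCommGroup EG] [NormedSpace ℝ EG] [FiniteDimensional ℝ EG]
  {G : Type*} [TopologicalSpace G] [ChartedSpace EG G] [Group G] [LieGroup 𝓘(ℝ, EG) ∞ G]

/-- The product rule in the form needed when a group element enters an expression twice. -/
lemma mvfderiv_diag {N : Type*} [TopologicalSpace N] [ChartedSpace EG N] [IsManifold 𝓘(ℝ, EG) 1 N]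
    {Φ : N × N → ℝ} {x : N}
    (hΦ : MDifferentiableAt (𝓘(ℝ, EG).prod 𝓘(ℝ, EG)) 𝓘(ℝ, ℝ) Φ (x, x)) (a : EG) :
    (mvfderiv 𝓘(ℝ, EG) (fun y => Φ (y, y)) x a : ℝ) =
      mvfderiv 𝓘(ℝ, EG) (fun y => Φ (y, x)) x a + mvfderiv 𝓘(ℝ, EG) (fun y => Φ (x, y)) x a := by
  have h1 := (HasMFDerivAt.comp (g := Φ) (f := fun y => (y, y)) x hΦ.hasMFDerivAt
    ((hasMFDerivAt_id x).prodMk (hasMFDerivAt_id x))).mfderiv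
  exact (DFunLike.congr_fun h1 a).trans (mfderiv_prod_eq_add_apply hΦ)

variable {E : Type*} [NormedAddCommGroup E] [NormedSpace ℝ E]
  {M : Type*} [TopologicalSpace M] [ChartedSpace E M] [IsManifold 𝓘(ℝ, E) ∞ M]
  [MulAction G M] [ContMDiffSMul 𝓘(ℝ, EG) 𝓘(ℝ, E) ∞ G M]

lemma contMDiff_orbit (y : M) : ContMDiff 𝓘(ℝ, EG) 𝓘(ℝ, E) ∞ (fun g : G => g • y) :=
  contMDiff_id.smul contMDiff_const

/-- The sign reflects the inverse in `infAction`. It comes from differentiating the constant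
function `g ↦ u((g g⁻¹) · y)` along the diagonal. -/
lemma mvfderiv_orbit {u : M → ℝ} (hu : ContMDiff 𝓘(ℝ, E) 𝓘(ℝ, ℝ) ∞ u) (a : LieAlg EG G) (y : M) :
    (mvfderiv 𝓘(ℝ, EG) (fun g : G => u (g • y)) 1 a : ℝ) =
      -mvfderiv 𝓘(ℝ, E) u y (infAction E a y) := by
  have : IsManifold 𝓘(ℝ, EG) 1 G := IsManifold.of_le (n := ∞) (by simp)
  have hinv : MDifferentiableAt 𝓘(ℝ, EG) 𝓘(ℝ, E) (fun g : G => g⁻¹ • y) 1 :=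
    ((contMDiff_orbit y).comp (contMDiff_inv 𝓘(ℝ, EG) ∞)).mdifferentiable (by simp) 1
  have h1 : mvfderiv 𝓘(ℝ, EG) (fun g : G => u (g⁻¹ • y)) 1 a =
      mvfderiv 𝓘(ℝ, E) u y (infAction E a y) :=
    mvfderiv_comp_apply_of_eq (1 : G) (hu.mdifferentiable (by simp) y) hinv (by simp) a
  have hΦ : ContMDiff (𝓘(ℝ, EG).prod 𝓘(ℝ, EG)) 𝓘(ℝ, ℝ) ∞
      (fun p : G × G => u ((p.1 * p.2⁻¹) • y)) :=
    hu.comp ((contMDiff_orbit y).comp (contMDiff_fst.mul contMDiff_snd.inv))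
  have h2 := mvfderiv_diag (hΦ.mdifferentiable (by simp) ((1 : G), (1 : G))) a
  simp only [mul_inv_cancel, inv_one, mul_one, one_mul] at h2
  rw [mvfderiv_const] at h2
  have h3 : (0 : ℝ) = mvfderiv 𝓘(ℝ, EG) (fun g : G => u (g • y)) 1 a +
    mvfderiv 𝓘(ℝ, EG) (fun g : G => u (g⁻¹ • y)) 1 a := h2
  rw [h1] at h3
  linarith

/-- An infinitesimally equivariant family of functions on `M`, linear in `𝔤`, is equivariant under
the connected group `G`. -/
lemma apply_smul_eq_of_infinitesimal [ConnectedSpace G] (u : LieAlg EG G →ₗ[ℝ] (M → ℝ))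
    (hu : ∀ b, ContMDiff 𝓘(ℝ, E) 𝓘(ℝ, ℝ) ∞ (u b))
    (h : ∀ (a b : LieAlg EG G) (x : M), mvfderiv 𝓘(ℝ, E) (u b) x (infAction E a x) = u ⁅a, b⁆ x)
    (g : G) (x : M) (b : LieAlg EG G) : u b (g • x) = u (Ad g⁻¹ b) x := by
  have : IsManifold 𝓘(ℝ, EG) 1 G := IsManifold.of_le (n := ∞) (by simp)
  let w : EG →ₗ[ℝ] (M → ℝ) := u
  let β := Module.finBasis ℝ EG
  -- Smoothness is given only for each fixed Lie algebra element, so joint smoothness is read off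
  -- from a basis expansion.
  have hsum : ∀ (c : EG) (y : M), w c y = ∑ i, β.repr c i * w (β i) y := by
    intro c y
    conv_lhs => rw [← β.sum_repr c, map_sum, Finset.sum_apply]
    simp
  have hsm : ∀ (y : M) (c : EG), ContMDiff (𝓘(ℝ, EG).prod 𝓘(ℝ, EG)) 𝓘(ℝ, ℝ) ∞
      (fun p : G × G => w (adCLM (EG := EG) p.1 c) (p.2 • y)) := by
    intro y c
    rw [show (fun p : G × G => w (adCLM (EG := EG) p.1 c) (p.2 • y)) = fun p =>
      ∑ i, β.repr (adCLM (EG := EG) p.1 c) i * w (β i) (p.2 • y) from funext fun _ => hsum _ _]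
    refine ContMDiff.sum fun i _ => ContMDiff.mul ?_ ?_
    · have h1 : ContMDiff 𝓘(ℝ, EG →L[ℝ] EG) 𝓘(ℝ, ℝ) ∞ (fun A : EG →L[ℝ] EG =>
          ((β.coord i).toContinuousLinearMap ∘L ContinuousLinearMap.apply ℝ EG c) A) :=
        ContinuousLinearMap.contMDiff _
      exact h1.comp (contMDiff_adCLM.comp contMDiff_fst)
    · exact (hu (β i)).comp ((contMDiff_orbit y).comp contMDiff_snd)
  have hone : ∀ (y : M) (c : EG),
      mvfderiv 𝓘(ℝ, EG) (fun k : G => w (adCLM (EG := EG) k c) (k • y)) 1 = 0 := by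
    intro y c
    refine ContinuousLinearMap.ext fun (a : EG) => ?_
    refine (mvfderiv_diag ((hsm y c).mdifferentiable (by simp) ((1 : G), (1 : G))) a).trans ?_
    simp only [adCLM_one, one_smul, ContinuousLinearMap.id_apply]
    have h1 : (mvfderiv 𝓘(ℝ, EG) (fun k : G => w c (k • y)) 1 a : ℝ) = -w (modelLie EG G a c) y :=
      (mvfderiv_orbit (hu c) a y).trans (congrArg Neg.neg (h a c y))
    have hAd : MDifferentiableAt 𝓘(ℝ, EG) 𝓘(ℝ, EG) (fun g : G => adCLM (EG := EG) g c) 1 :=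
      (((ContinuousLinearMap.apply ℝ EG c).contMDiff (n := ∞)).comp
        (contMDiff_adCLM (G := G))).mdifferentiable (by simp) 1
    have h2 : (mvfderiv 𝓘(ℝ, EG) (fun k : G => w (adCLM (EG := EG) k c) y) 1 a : ℝ) =
        w (modelLie EG G a c) y :=
      (mvfderiv_clm_comp (((LinearMap.proj y).comp w).toContinuousLinearMap) hAd a).trans
        (congrArg (fun d => w d y) (mvfderiv_adCLM_apply (EG := EG) (G := G) a c))
    rw [h1, h2, add_neg_cancel]
    rfl
  have hdiff : ∀ (y : M) (c : EG), MDifferentiable 𝓘(ℝ, EG) 𝓘(ℝ, ℝ)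
      (fun k : G => w (adCLM (EG := EG) k c) (k • y)) := fun y c =>
    ((hsm y c).comp (contMDiff_id.prodMk contMDiff_id)).mdifferentiable (by simp)
  have hzero : ∀ (c : EG) (k : G),
      mvfderiv 𝓘(ℝ, EG) (fun k : G => w (adCLM (EG := EG) k c) (k • x)) k = 0 := by
    intro c k
    -- Right translation by `k⁻¹` moves the derivative at `k` to `1`, with `Ad k c` and `k • x` in
    -- place of `c` and `x`.
    have hk : (fun k : G => w (adCLM (EG := EG) k c) (k • x)) =
        (fun h : G => w (adCLM (EG := EG) h (adCLM (EG := EG) k c)) (h • k • x)) ∘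
          fun l => l * k⁻¹ := by
      ext l
      simp only [Function.comp_apply]
      rw [← adCLM_mul, smul_smul, inv_mul_cancel_right]
    have hr : MDifferentiableAt 𝓘(ℝ, EG) 𝓘(ℝ, EG) (fun l : G => l * k⁻¹) k :=
      (contMDiff_mul_right (I := 𝓘(ℝ, EG)) (n := ∞)).mdifferentiable (by simp) k
    ext a
    rw [hk, mvfderiv_comp_apply_of_eq (y := 1) k (hdiff _ _ _) hr (by simp), hone]
    rfl
  have hconst : ∀ c : EG, w (adCLM (EG := EG) g c) (g • x) = w c x := by
    intro c
    have := eq_of_mvfderiv_eq_zero (hdiff x c) (hzero c) g 1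
    rwa [adCLM_one, one_smul] at this
  -- The constancy statement is applied to `c = Ad g⁻¹ b`.
  have hgb : ∀ c : EG, adCLM (EG := EG) g (adCLM (EG := EG) g⁻¹ c) = c := by
    intro c
    rw [← adCLM_mul, mul_inv_cancel, adCLM_one]
    rfl
  exact (congrArg (fun c => w c (g • x)) (hgb b)).symm.trans (hconst _)

end Equivariance

/-! ## Trivially extended Hamiltonian actions -/

section Hamiltonian

variable {EG : Type*} [NormedAddCommGroup EG] [NormedSpace ℝ EG] [FiniteDimensional ℝ EG]
  {G : Type*} [TopologicalSpace G] [ChartedSpace EG G] [Group G] [LieGroup 𝓘(ℝ, EG) ∞ G]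
  {E : Type*} [NormedAddCommGroup E] [NormedSpace ℝ E]
  {M : Type*} [TopologicalSpace M] [ChartedSpace E M] [IsManifold 𝓘(ℝ, E) ∞ M]
  [MulAction G M]

namespace EquivariantFunction

variable (f : EquivariantFunction EG G E M)

lemma mvfderiv_re (a b : LieAlg EG G) (x : M) :
    mvfderiv 𝓘(ℝ, E) (f.re b) x (infAction E a x) = f.re ⁅a, b⁆ x :=
  (mvfderiv_clm_comp Complex.reCLM ((f.contMDiff (1 ⊗ₜ[ℝ] b)).mdifferentiable (by simp) x) _).trans
    (congrArg Complex.re (f.equivariant a b x))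

lemma mvfderiv_im (a b : LieAlg EG G) (x : M) :
    mvfderiv 𝓘(ℝ, E) (f.im b) x (infAction E a x) = f.im ⁅a, b⁆ x :=
  (mvfderiv_clm_comp Complex.imCLM ((f.contMDiff (1 ⊗ₜ[ℝ] b)).mdifferentiable (by simp) x) _).trans
    (congrArg Complex.im (f.equivariant a b x))

/-- Group equivariance is needed for the real part alone, since only `Re f` enters the equivalence.
-/
lemma re_smul [ContMDiffSMul 𝓘(ℝ, EG) 𝓘(ℝ, E) ∞ G M] [ConnectedSpace G]
    (g : G) (x : M) (b : LieAlg EG G) : f.re b (g • x) = f.re (Ad g⁻¹ b) x :=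
  apply_smul_eq_of_infinitesimal (E := E)
    { toFun := fun b => f.re b
      map_add' := fun a b => by rw [map_add]; rfl
      map_smul' := fun c a => by rw [map_smul]; rfl }
    (fun b => (f.re b).contMDiff) f.mvfderiv_re g x b

end EquivariantFunction

variable {FV : Type*} [NormedAddCommGroup FV] [NormedSpace ℝ FV] [FiniteDimensional ℝ FV]
  {V : M → Type*} [TopologicalSpace (TotalSpace FV V)]
  [∀ x, AddCommGroup (V x)] [∀ x, Module ℝ (V x)] [∀ x, TopologicalSpace (V x)]
  [FiberBundle FV V] [VectorBundle ℝ FV V] [ContMDiffVectorBundle ∞ FV V 𝓘(ℝ, E)]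
  [FiniteDimensional ℝ E] [T2Space M]
  {C : CourantAlgebroid E FV V}

namespace IsExtendedAction

variable {ρ : LieAlg EG G →ₗ[ℝ] SmoothSec E FV V}

/-- Subtracting an equivariant family of exact sections from a trivially extended action. -/
lemma sub_D (hC : C.IsExact) (hρ : IsExtendedAction C (CourantAlgebra.trivial (LieAlg EG G)) ρ)
    (u : LieAlg EG G →ₗ[ℝ] SmoothFun E M)
    (hu : ∀ (a b : LieAlg EG G) (x : M),
      mvfderiv 𝓘(ℝ, E) (u b) x (infAction E a x) = u ⁅a, b⁆ x) :
    IsExtendedAction C (CourantAlgebra.trivial (LieAlg EG G)) (ρ - C.D ∘ₗ u) where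
  exact := hρ.exact
  map_bracket a b := by
    -- Of the correction terms in the bracket only this one survives, and equivariance of `u` gives
    -- it the required value.
    have h : C.bracket (ρ a) (C.D (u b)) = C.D (u ⁅a, b⁆) :=
      C.bracket_D_right_eq fun x => by rw [hρ.anchor_eq]; exact hu a b x
    simp only [LinearMap.sub_apply, LinearMap.comp_apply, map_sub, C.bracket_D_left, sub_zero, h,
      hρ.map_bracket]
    rfl
  anchor_eq a x := by
    change C.anchor x (ρ a x - C.D (u a) x) = _
    rw [map_sub, hC.anchor_D, sub_zero, hρ.anchor_eq]
  kernel_acts_trivially h hh e := by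
    have : h = 0 := hh
    rw [this, map_zero, map_zero, LinearMap.zero_apply]
  integrates := by
    -- The operators `[ρ(a), ·]` are unchanged, so the same bundle action serves.
    obtain ⟨Φ, hΦ⟩ := hρ.integrates
    refine ⟨Φ, fun a e => ?_⟩
    simpa only [LinearMap.sub_apply, LinearMap.comp_apply, map_sub, C.bracket_D_left, sub_zero]
      using hΦ a e

/-- An equivariant family of functions `u` extends a trivially extended action to the
hemisemidirect product, by `(g, h) ↦ ρ(g) + 𝒟 u_h`. -/
lemma hemisemidirect (hC : C.IsExact)
    (hρ : IsExtendedAction C (CourantAlgebra.trivial (LieAlg EG G)) ρ)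
    (u : LieAlg EG G →ₗ[ℝ] SmoothFun E M)
    (hu : ∀ (a b : LieAlg EG G) (x : M),
      mvfderiv 𝓘(ℝ, E) (u b) x (infAction E a x) = u ⁅a, b⁆ x) :
    IsExtendedAction C (CourantAlgebra.hemisemidirect (LieAlg EG G) (LieAlg EG G))
      (ρ.coprod (C.D ∘ₗ u)) where
  exact := by
    refine ⟨fun g => ⟨(g, 0), rfl⟩, ?_⟩
    rintro ⟨g₁, h₁⟩ hh₁ ⟨g₂, h₂⟩ hh₂
    obtain rfl : g₁ = 0 := hh₁
    obtain rfl : g₂ = 0 := hh₂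
    exact Prod.ext (zero_lie _) (zero_lie _)
  map_bracket := by
    rintro ⟨g₁, h₁⟩ ⟨g₂, h₂⟩
    -- Since `𝒟 u_{h₁}` acts trivially from the left, `h₁` drops out, exactly as in the
    -- hemisemidirect bracket.
    have h : C.bracket (ρ g₁) (C.D (u h₂)) = C.D (u ⁅g₁, h₂⁆) :=
      C.bracket_D_right_eq fun x => by rw [hρ.anchor_eq]; exact hu g₁ h₂ x
    simp only [LinearMap.coprod_apply, LinearMap.comp_apply, map_add, LinearMap.add_apply,
      C.bracket_D_left, add_zero, h, ← hρ.map_bracket]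
    rfl
  anchor_eq a x := by
    change C.anchor x (ρ a.1 x + C.D (u a.2) x) = _
    rw [map_add, hC.anchor_D, add_zero, hρ.anchor_eq]
    rfl
  kernel_acts_trivially := by
    rintro ⟨g, h⟩ hh e
    obtain rfl : g = 0 := hh
    simp [C.bracket_D_left]
  integrates := by
    obtain ⟨Φ, hΦ⟩ := hρ.integrates
    refine ⟨Φ, fun a e => ?_⟩
    have h : C.bracket (ρ.coprod (C.D ∘ₗ u) a) e = C.bracket (ρ a.1) e := by
      simp only [LinearMap.coprod_apply, LinearMap.comp_apply, map_add, LinearMap.add_apply,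
        C.bracket_D_left, add_zero]
    rw [h]
    exact hΦ a.1 e

end IsExtendedAction

/-- On `(0, h)` the extended map is `𝒟 u_h` by construction, so the content is the equivariance of
`u`. -/
lemma isMomentMap_hemisemidirect (ρ : LieAlg EG G →ₗ[ℝ] SmoothSec E FV V)
    (u : LieAlg EG G →ₗ[ℝ] SmoothFun E M)
    (hu : ∀ (a b : LieAlg EG G) (x : M),
      mvfderiv 𝓘(ℝ, E) (u b) x (infAction E a x) = u ⁅a, b⁆ x) :
    IsMomentMap C (CourantAlgebra.hemisemidirect (LieAlg EG G) (LieAlg EG G))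
      (ρ.coprod (C.D ∘ₗ u))
      (u ∘ₗ LinearMap.snd ℝ (LieAlg EG G) (LieAlg EG G) ∘ₗ
        (CourantAlgebra.hemisemidirect (LieAlg EG G) (LieAlg EG G)).kernel.subtype) := by
  refine ⟨fun a h x => hu a.1 h.1.2 x, ?_⟩
  rintro ⟨⟨g, h⟩, hh⟩
  obtain rfl : g = 0 := hh
  simp

/-- Subtracting an equivariant family of exact sections gives an equivalent action, when the family
is equivariant under the group. -/
lemma areEquivalentActions_sub_D (ρ : LieAlg EG G →ₗ[ℝ] SmoothSec E FV V)
    (u : LieAlg EG G →ₗ[ℝ] SmoothFun E M)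
    (hu : ∀ (g : G) (x : M) (b : LieAlg EG G), u b (g • x) = u (Ad g⁻¹ b) x) :
    AreEquivalentActions C (CourantAlgebra.trivial (LieAlg EG G)) ρ (ρ - C.D ∘ₗ u) := by
  -- The function realising the equivalence is `-u`.
  refine ⟨fun h hh => ?_, fun x =>
    { toFun := fun a => -u a x
      map_add' := fun a b => ?_
      map_smul' := fun c a => ?_ }, fun a => (-u a).contMDiff, fun g x => ?_, fun a => ?_⟩
  · have : h = 0 := hh
    rw [this, map_zero, map_zero]
  · rw [map_add, ContMDiffMap.coe_add, Pi.add_apply, neg_add]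
  · rw [map_smul, ContMDiffMap.coe_smul, Pi.smul_apply, smul_neg]
    rfl
  · ext b
    exact congrArg Neg.neg (hu g x b)
  · change (ρ a - C.D (u a)) - ρ a = C.D (-u a)
    rw [map_neg]
    abel

/-- If `σ(a) = -𝒥 (𝒟 u_a)`, the image distribution of `(g, h) ↦ σ(g) + 𝒟 u_h` is `𝒥`-invariant. -/
lemma GeneralizedComplexStructure.map_imageDistribution_coprod
    (𝒥 : GeneralizedComplexStructure C) {𝔤 : Type*} [AddCommGroup 𝔤] [Module ℝ 𝔤]
    (σ : 𝔤 →ₗ[ℝ] SmoothSec E FV V) (u : 𝔤 →ₗ[ℝ] SmoothFun E M)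
    (h : ∀ a, σ a = -𝒥.onSec (C.D (u a))) (x : M) :
    Submodule.map (𝒥.J x) (imageDistribution (σ.coprod (C.D ∘ₗ u)) x) =
      imageDistribution (σ.coprod (C.D ∘ₗ u)) x := by
  have hval : ∀ g k, (σ.coprod (C.D ∘ₗ u)) (g, k) x =
      -𝒥.J x (C.D (u g) x) + C.D (u k) x := by
    intro g k
    change σ g x + C.D (u k) x = _
    rw [h]
    rfl
  have hle : Submodule.map (𝒥.J x) (imageDistribution (σ.coprod (C.D ∘ₗ u)) x) ≤
      imageDistribution (σ.coprod (C.D ∘ₗ u)) x := by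
    rw [imageDistribution, Submodule.map_span, Submodule.span_le]
    rintro _ ⟨_, ⟨⟨g, k⟩, rfl⟩, rfl⟩
    -- The preimage comes from `𝒥(-𝒥 𝒟u_g + 𝒟u_k) = 𝒥 𝒟u_k + 𝒟u_g`.
    refine Submodule.subset_span ⟨(-k, g), ?_⟩
    simp only [hval, map_add, map_neg, 𝒥.J_J, ContMDiffSection.coe_neg, Pi.neg_apply]
    abel
  -- The reverse inclusion uses `𝒥⁻¹ = -𝒥`, which preserves the distribution by `hle`.
  refine le_antisymm hle fun v hv => ⟨-𝒥.J x v, ?_, ?_⟩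
  · exact neg_mem (hle (Submodule.mem_map_of_mem hv))
  · rw [map_neg, 𝒥.J_J, neg_neg]

end Hamiltonian

theorem mainTheorem8
    {EG : Type*} [NormedAddCommGroup EG] [NormedSpace ℝ EG] [FiniteDimensional ℝ EG]
    {G : Type*} [TopologicalSpace G] [ChartedSpace EG G] [Group G] [LieGroup 𝓘(ℝ, EG) ∞ G]
    [ConnectedSpace G]
    {E : Type*} [NormedAddCommGroup E] [NormedSpace ℝ E] [FiniteDimensional ℝ E]
    {M : Type*} [TopologicalSpace M] [ChartedSpace E M] [IsManifold 𝓘(ℝ, E) ∞ M] [T2Space M]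
    [MulAction G M] [ContMDiffSMul 𝓘(ℝ, EG) 𝓘(ℝ, E) ∞ G M]
    {FV : Type*} [NormedAddCommGroup FV] [NormedSpace ℝ FV] [FiniteDimensional ℝ FV]
    {V : M → Type*} [TopologicalSpace (TotalSpace FV V)]
    [∀ x, AddCommGroup (V x)] [∀ x, Module ℝ (V x)] [∀ x, TopologicalSpace (V x)]
    [FiberBundle FV V] [VectorBundle ℝ FV V] [ContMDiffVectorBundle ∞ FV V 𝓘(ℝ, E)]
    (C : CourantAlgebroid E FV V) (hC : C.IsExact)
    (𝒥 : GeneralizedComplexStructure C)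
    (ρ : LieAlg EG G →ₗ[ℝ] SmoothSec E FV V)
    (hρ : IsExtendedAction C (CourantAlgebra.trivial (LieAlg EG G)) ρ)
    (hiso : IsIsotropicAction C ρ)
    (f : EquivariantFunction EG G E M)
    (hham : ∀ a, ρ a = 𝒥.hamiltonian (f.comp a)) :
    -- the action `a ↦ ρ(a) - d(Re f_a)` is a trivially extended action equivalent to `ρ`
    IsExtendedAction C (CourantAlgebra.trivial (LieAlg EG G)) (ρ - C.D ∘ₗ f.re) ∧
    AreEquivalentActions C (CourantAlgebra.trivial (LieAlg EG G)) ρ (ρ - C.D ∘ₗ f.re) ∧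
    -- it extends to the hemisemidirect product `𝔤 ⊕ 𝔤`
    ∃ ρ' : LieAlg EG G × LieAlg EG G →ₗ[ℝ] SmoothSec E FV V,
      IsExtendedAction C (CourantAlgebra.hemisemidirect (LieAlg EG G) (LieAlg EG G)) ρ' ∧
      (∀ a, ρ' (a, 0) = (ρ - C.D ∘ₗ f.re) a) ∧
      IsMomentMap C (CourantAlgebra.hemisemidirect (LieAlg EG G) (LieAlg EG G)) ρ'
        (f.im ∘ₗ LinearMap.snd ℝ (LieAlg EG G) (LieAlg EG G) ∘ₗ
          (CourantAlgebra.hemisemidirect (LieAlg EG G) (LieAlg EG G)).kernel.subtype) ∧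
      ∀ x, Submodule.map (𝒥.J x) (imageDistribution ρ' x) = imageDistribution ρ' x := by
  -- The real part of the Hamiltonian symmetry cancels, leaving the form that makes `K` invariant
  -- under `𝒥`.
  have hsub : ∀ a, (ρ - C.D ∘ₗ f.re) a = -𝒥.onSec (C.D (f.im a)) := by
    intro a
    rw [LinearMap.sub_apply, hham]
    exact sub_sub_cancel_left _ _
  have hρ' := hρ.sub_D hC f.re f.mvfderiv_re
  exact ⟨hρ', areEquivalentActions_sub_D ρ f.re f.re_smul, _,
    hρ'.hemisemidirect hC f.im f.mvfderiv_im, fun a => by simp,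
    isMomentMap_hemisemidirect _ f.im f.mvfderiv_im,
    𝒥.map_imageDistribution_coprod _ f.im hsub⟩
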